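/- Let $\mathbb{G}^3$ be the geometric (Clifford) algebra of Euclidean space $\mathbb{R}^3$ with orthonormal basis $e_1,e_2,e_3$ and unit pseudoscalar $I=e_1e_2e_3$. For $A$ of grade $r$ and $B$ of grade $s$, with $r,s\ge 1$, let $A\cdot B=\langle AB\rangle_{|r-s|}$ be the inner product, and let $A\times B=\tfrac12(AB-BA)$ be the commutator product of multivectors. For a differentiable multivector field $F$ let $\nabla\cdot F=\sum_i e_i\cdot\partial_iF$. Let $M\subset\mathbb{R}^3$ be a compact region (the closure of its interior) with piecewise smooth boundary: $\partial M$ has finite area and, apart from a subset of area zero (edges and corners), it is locally a $C^1$ surface with $M$ on one side of it. Let $n$ be the outward unit normal on the smooth part of $\partial M$, $dS$ the surface area, $dV=|d\mathbf{x}^3|$ the volume, and let $d\mathbf{x}^3=I\,dV$ and $d\mathbf{x}^2=I\,n\,dS$ be the directed volume and surface elements. (a) For every bivector field $F$ on $M$ that is continuously differentiable up to the boundary, both integrands below are integrable and $$\iiint_M d\mathbf{x}^3\cdot(\nabla\cdot F)=\oiint_{\partial M}d\mathbf{x}^2\times F .$$ (b) (Dual form.) For every vector field $B$ on $M$ that is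 continuously differentiable up to the boundary, $IB$ is a bivector field, one has $I\cdot(\nabla\cdot(IB))=-I\,(\nabla\times B)$ in the interior of $M$ and $(I n)\times(IB)=I\,(B\times n)$ on the smooth part of $\partial M$ (on the right-hand sides, $\times$ is the cross product of vectors), the integrands below are integrable, and $$\iiint_M \nabla\times B\,dV=-\oiint_{\partial M}B\times n\,dS .$$ -/

import Mathlib

open MeasureTheory Topology
open scoped Gradient

noncomputable section

namespace GeomCalc

/-- Euclidean three-space. -/
abbrev E3 : Type := EuclideanSpace ℝ (Fin 3)

/-- The standard orthonormal basis vector `e i`. -/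
def e (i : Fin 3) : E3 := EuclideanSpace.single i 1

/-- The quadratic form `Q v = ⟪v, v⟫` of Euclidean three-space. -/
def Q3 : QuadraticForm ℝ E3 := LinearMap.BilinMap.toQuadraticMap (innerₗ E3)

/-- The geometric algebra of Euclidean three-space; its multiplication is the geometric product. -/
abbrev G3 : Type := CliffordAlgebra Q3

/-- A vector, seen as a multivector. -/
def vec : E3 →ₗ[ℝ] G3 := CliffordAlgebra.ι Q3

/-- The canonical (grade-preserving) linear identification with the exterior algebra. -/
def toExterior : G3 ≃ₗ[ℝ] ExteriorAlgebra ℝ E3 := CliffordAlgebra.equivExterior Q3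

/-- The basis of the eight blades `e s`, `s ⊆ {0, 1, 2}`. -/
def bladeBasis : Module.Basis (Finset (Fin 3)) ℝ G3 :=
  (Module.Basis.ExteriorAlgebra (EuclideanSpace.basisFun (Fin 3) ℝ).toBasis).map toExterior.symm

/-- The coordinates of a multivector in the blade basis. -/
def bladeCoords : G3 ≃ₗ[ℝ] EuclideanSpace ℝ (Finset (Fin 3)) :=
  bladeBasis.equivFun.trans (WithLp.linearEquiv 2 ℝ (Finset (Fin 3) → ℝ)).symm

/-- The Euclidean norm of the blade coordinates. (All norms on `G3` are equivalent; the norm is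
only used to speak of derivatives and integrals of multivector fields.) -/
instance instNormedAddCommGroupG3 : NormedAddCommGroup G3 :=
  NormedAddCommGroup.induced G3 (EuclideanSpace ℝ (Finset (Fin 3))) bladeCoords.toLinearMap
    bladeCoords.injective

instance instNormedSpaceG3 : NormedSpace ℝ G3 :=
  NormedSpace.induced ℝ G3 (EuclideanSpace ℝ (Finset (Fin 3))) bladeCoords.toLinearMap

/-- The space of `k`-vectors (homogeneous multivectors of grade `k`). -/
def grade (k : ℕ) : Submodule ℝ G3 := (⋀[ℝ]^k E3).comap toExterior.toLinearMap

/-- The grade-`k` part of a multivector. -/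
def gradePart (k : ℕ) : G3 →ₗ[ℝ] G3 :=
  toExterior.symm.toLinearMap ∘ₗ
    GradedAlgebra.proj (fun i : ℕ => ⋀[ℝ]^i E3) k ∘ₗ toExterior.toLinearMap

/-- The inner product of multivectors: the bilinear extension of `A · B = ⟨A B⟩_{|r - s|}` for
`A` of grade `r` and `B` of grade `s`, where the inner product with a scalar is zero. -/
def dot (A B : G3) : G3 :=
  ∑ r ∈ Finset.Icc 1 3, ∑ s ∈ Finset.Icc 1 3,
    gradePart ((r - s) + (s - r)) (gradePart r A * gradePart s B)

/-- The commutator product `A × B = (AB - BA) / 2`. -/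
def comm (A B : G3) : G3 := (1 / 2 : ℝ) • (A * B - B * A)

/-- The unit pseudoscalar `e₁ e₂ e₃`. -/
def I3 : G3 := vec (e 0) * vec (e 1) * vec (e 2)

/-- The generalized divergence `∇ · F = ∑ᵢ eᵢ · ∂ᵢ F` of a multivector field. -/
def mvDiv (F : E3 → G3) (x : E3) : G3 := ∑ i, dot (vec (e i)) (fderiv ℝ F x (e i))

/-- The cross product of vectors. -/
def cross (a b : E3) : E3 := WithLp.toLp 2 (crossProduct a.ofLp b.ofLp)

/-- The classical curl `∇ × B = ∑ᵢ eᵢ × ∂ᵢ B` of a vector field. -/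
def curl (B : E3 → E3) (x : E3) : E3 := ∑ i, cross (e i) (fderiv ℝ B x (e i))

/-- `n` is the outward unit normal of `M` at the smooth boundary point `x`: near `x` the set `M`
is the sublevel set `{g ≤ 0}` of a `C¹` function `g` that vanishes at `x` with `∇g(x) ≠ 0`,
and `n = ∇g(x) / ‖∇g(x)‖`. -/
def IsOutwardUnitNormal (M : Set E3) (x n : E3) : Prop :=
  ∃ g : E3 → ℝ, ContDiffAt ℝ 1 g x ∧ g x = 0 ∧ ∇ g x ≠ 0 ∧
    (∀ᶠ y in 𝓝 x, y ∈ M ↔ g y ≤ 0) ∧ n = ‖∇ g x‖⁻¹ • ∇ g x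

/-- The smooth part of the boundary of `M`. -/
def smoothBoundary (M : Set E3) : Set E3 := {x | ∃ n, IsOutwardUnitNormal M x n}

open Classical in
/-- The outward unit normal field on the smooth part of the boundary of `M` (zero elsewhere). -/
def outwardNormal (M : Set E3) (x : E3) : E3 :=
  if h : ∃ n, IsOutwardUnitNormal M x n then h.choose else 0

/-- `M` is a compact region of space (the closure of its interior) with piecewise smooth boundary:
the boundary has finite area, and it is a `C¹` surface with `M` on one side of it, apart from a
set of edges and corners, which has area zero. -/
structure IsRegion (M : Set E3) : Prop where
  isCompact : IsCompact M
  closure_interior : closure (interior M) = M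
  area_lt_top : μHE[2] (frontier M) < ⊤
  area_singular : μHE[2] (frontier M \ smoothBoundary M) = 0

/-- Surface area on the boundary of `M`. -/
def surfaceMeasure (M : Set E3) : Measure E3 := μHE[2].restrict (frontier M)

/-- The density `I n` of the directed (bivector) area element `dx² = I n dS` of the boundary,
oriented by the outward unit normal `n`. -/
def areaElement (M : Set E3) (x : E3) : G3 := I3 * vec (outwardNormal M x)

end GeomCalc

end

noncomputable section

namespace GeomCalc

/-! ### The geometric algebra of three-space -/

/-! Algebra reduces both parts to one identity about vector fields. In `G3` the pseudoscalar `I` is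
central with `I² = -1`, and `ab = a · b + I (a × b)`. Hence every bivector is `I b` for a vector
`b`, `a · (I b) = -(a × b)`, and the commutator of `I n` and `I b` is `I (b × n)`. Both integrands
of (a) for `F = I B` are therefore duals of those of `∫ curl B = -∫ B × n`. Since `curl B = ∑ eᵢ ×
∂ᵢB`, this follows from the divergence theorem for one directional derivative, `∫_M ∂_v f = ∫_{∂M}
(v · n) f` (`IsRegion.integral_interior_fderiv_eq`).

That theorem is proved without an area formula, by letting a slope `δ` tend to zero. Near a smooth
boundary point with normal `N`, the boundary is a graph over the plane `N⊥` of slope of order `δ`.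
In direction `N`, Fubini and the fundamental theorem of calculus give an exact identity with
projected area in place of area (`integral_fderiv_normal`), and Lipschitz bounds show that the two
areas agree up to a factor `1 + 8 δ`. Derivatives orthogonal to `N` integrate to `O(δ)`
(`norm_integral_fderiv_tangential_le`). So the local defect is at most a constant times `δ` times
the boundary integral of the cutoff. Summed over a partition of unity, the defects are bounded by
`δ` times the total area, and `δ → 0` removes them (`integral_fderiv_eq_of_disjoint`).

Edges and corners form a compact set of zero area, so finitely many balls with small `∑ r²` cover
it. A cutoff of gradient `O(1/r)` on each ball, whose volume is `O(r³)`, costs `O(∑ r²)` in the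
volume integral (`exists_cutoff`); in the limit it disappears. -/

lemma associated_neg_Q3 (u v : E3) :
    QuadraticMap.associated (R := ℝ) (-Q3) u v = -inner ℝ u v := by
  have h := QuadraticMap.associated_left_inverse ℝ
    (B₁ := -(innerₗ E3 : LinearMap.BilinForm ℝ E3))
    (fun x y => by simp [innerₗ_apply_apply, real_inner_comm])
  have h' : LinearMap.BilinMap.toQuadraticMap (-(innerₗ E3 : LinearMap.BilinForm ℝ E3)) = -Q3 := by
    rw [LinearMap.BilinMap.toQuadraticMap_neg]; rfl
  rw [h'] at h
  rw [h]; simp [innerₗ_apply_apply]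

lemma toExterior_vec (a : E3) : toExterior (vec a) = ExteriorAlgebra.ι ℝ a :=
  CliffordAlgebra.changeForm_ι CliffordAlgebra.changeForm.associated_neg_proof a

lemma toExterior_vec_mul (a : E3) (x : G3) :
    toExterior (vec a * x) = ExteriorAlgebra.ι ℝ a * toExterior x -
      CliffordAlgebra.contractLeft (QuadraticMap.associated (R := ℝ) (-Q3) a) (toExterior x) :=
  CliffordAlgebra.changeForm_ι_mul CliffordAlgebra.changeForm.associated_neg_proof a x

lemma toExterior_vec_mul_vec (a b : E3) :
    toExterior (vec a * vec b) = ExteriorAlgebra.ι ℝ a * ExteriorAlgebra.ι ℝ b +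
      algebraMap ℝ _ (inner ℝ a b) := by
  have h := CliffordAlgebra.changeForm_ι_mul_ι
    (CliffordAlgebra.changeForm.associated_neg_proof (Q := Q3)) a b
  refine Eq.trans h ?_
  rw [associated_neg_Q3, map_neg, sub_neg_eq_add]

lemma inner_e (i j : Fin 3) : inner ℝ (e i) (e j) = if i = j then (1 : ℝ) else 0 := by
  simp [e, EuclideanSpace.inner_single_left]

lemma vec_mul_self (a : E3) : vec a * vec a = algebraMap ℝ G3 (inner ℝ a a) :=
  CliffordAlgebra.ι_sq_scalar Q3 a

/-- Polarization of `v² = ⟪v, v⟫`. -/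
lemma vec_mul_add_swap (a b : E3) :
    vec a * vec b + vec b * vec a = algebraMap ℝ G3 (2 * inner ℝ a b) := by
  have h := vec_mul_self (a + b)
  rw [map_add, mul_add, add_mul, add_mul, vec_mul_self, vec_mul_self, real_inner_add_add_self,
    map_add, map_add] at h
  rw [← sub_eq_zero] at h ⊢
  rw [← h]; abel

lemma vec_e_mul_self (i : Fin 3) : vec (e i) * vec (e i) = 1 := by
  rw [vec_mul_self, inner_e, if_pos rfl, map_one]

lemma vec_e_mul_comm {i j : Fin 3} (h : i ≠ j) :
    vec (e i) * vec (e j) = -(vec (e j) * vec (e i)) := by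
  have := vec_mul_add_swap (e i) (e j)
  rw [inner_e, if_neg h, mul_zero, map_zero] at this
  exact eq_neg_of_add_eq_zero_left this

lemma vec_eq_sum (a : E3) :
    vec a = a 0 • vec (e 0) + a 1 • vec (e 1) + a 2 • vec (e 2) := by
  have : a = a 0 • e 0 + a 1 • e 1 + a 2 • e 2 := by
    ext i; fin_cases i <;> simp [e]
  conv_lhs => rw [this]
  simp only [map_add, map_smul]

/-- With the next lemma, this lets `simp` sort any right-nested word in the basis vectors into
increasing order and cancel squares, which settles identities in `G3` by computation. -/
lemma vec_e_mul_self_assoc (i : Fin 3) (w : G3) : vec (e i) * (vec (e i) * w) = w := by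
  rw [← mul_assoc, vec_e_mul_self, one_mul]

lemma vec_e_mul_comm_assoc {i j : Fin 3} (h : i ≠ j) (w : G3) :
    vec (e i) * (vec (e j) * w) = -(vec (e j) * (vec (e i) * w)) := by
  rw [← mul_assoc, vec_e_mul_comm h, neg_mul, mul_assoc]

lemma I3_mul_I3 : I3 * I3 = -1 := by
  simp only [I3, mul_assoc,
    vec_e_mul_comm_assoc (show (1 : Fin 3) ≠ 0 by decide),
    vec_e_mul_comm_assoc (show (2 : Fin 3) ≠ 0 by decide),
    vec_e_mul_comm_assoc (show (2 : Fin 3) ≠ 1 by decide),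
    vec_e_mul_self, vec_e_mul_self_assoc, mul_neg, neg_neg]

lemma vec_mul_I3 (a : E3) : vec a * I3 = I3 * vec a := by
  rw [vec_eq_sum]
  simp only [I3, mul_assoc, mul_add, add_mul, smul_mul_assoc, mul_smul_comm,
    vec_e_mul_comm (show (2 : Fin 3) ≠ 0 by decide),
    vec_e_mul_comm (show (2 : Fin 3) ≠ 1 by decide),
    vec_e_mul_comm_assoc (show (1 : Fin 3) ≠ 0 by decide),
    vec_e_mul_comm_assoc (show (2 : Fin 3) ≠ 0 by decide),
    vec_e_mul_comm_assoc (show (2 : Fin 3) ≠ 1 by decide),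
    vec_e_mul_self, vec_e_mul_self_assoc, mul_neg, neg_neg, mul_one]

lemma cross_apply (a b : E3) :
    cross a b = !₂[a 1 * b 2 - a 2 * b 1, a 2 * b 0 - a 0 * b 2, a 0 * b 1 - a 1 * b 0] := by
  simp [cross, _root_.cross_apply]

/-- The geometric product of two vectors: `ab = a · b + I (a × b)`. -/
lemma vec_mul_vec (a b : E3) :
    vec a * vec b = algebraMap ℝ G3 (inner ℝ a b) + I3 * vec (cross a b) := by
  rw [vec_eq_sum a, vec_eq_sum b, vec_eq_sum (cross a b), cross_apply]
  simp only [I3, mul_assoc, mul_add, add_mul, smul_mul_assoc, mul_smul_comm,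
    vec_e_mul_comm (show (1 : Fin 3) ≠ 0 by decide),
    vec_e_mul_comm (show (2 : Fin 3) ≠ 0 by decide),
    vec_e_mul_comm (show (2 : Fin 3) ≠ 1 by decide),
    vec_e_mul_comm_assoc (show (1 : Fin 3) ≠ 0 by decide),
    vec_e_mul_self, vec_e_mul_self_assoc, mul_neg, neg_neg, mul_one]
  simp only [PiLp.inner_apply, Fin.sum_univ_three, Algebra.algebraMap_eq_smul_one]
  simp
  module

lemma cross_swap (a b : E3) : cross b a = -cross a b := by
  simp only [cross]; rw [← cross_anticomm]; rfl

/-! ### Grades -/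

lemma mem_grade {k : ℕ} {A : G3} : A ∈ grade k ↔ toExterior A ∈ ⋀[ℝ]^k E3 := Iff.rfl

lemma gradePart_of_mem {k : ℕ} {A : G3} (h : A ∈ grade k) : gradePart k A = A := by
  simp only [gradePart, LinearMap.comp_apply, LinearEquiv.coe_coe]
  rw [GradedAlgebra.proj_apply, DirectSum.decompose_of_mem_same (fun i : ℕ => ⋀[ℝ]^i E3) (mem_grade.1 h)]
  simp

lemma gradePart_of_mem_ne {j k : ℕ} {A : G3} (h : A ∈ grade k) (hjk : k ≠ j) :
    gradePart j A = 0 := by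
  simp only [gradePart, LinearMap.comp_apply, LinearEquiv.coe_coe]
  rw [GradedAlgebra.proj_apply, DirectSum.decompose_of_mem_ne (fun i : ℕ => ⋀[ℝ]^i E3) (mem_grade.1 h) hjk]
  simp

lemma dot_of_mem {r s : ℕ} {A B : G3} (hA : A ∈ grade r) (hB : B ∈ grade s)
    (hr : r ∈ Finset.Icc 1 3) (hs : s ∈ Finset.Icc 1 3) :
    dot A B = gradePart ((r - s) + (s - r)) (A * B) := by
  unfold dot
  rw [Finset.sum_eq_single_of_mem r hr, Finset.sum_eq_single_of_mem s hs,
    gradePart_of_mem hA, gradePart_of_mem hB]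
  · intro t _ ht
    rw [gradePart_of_mem_ne hB ht.symm, mul_zero, map_zero]
  · intro t _ ht
    simp [gradePart_of_mem_ne hA ht.symm]

lemma exteriorPower_eq (k : ℕ) :
    ⋀[ℝ]^k E3 = (LinearMap.range (ExteriorAlgebra.ι ℝ : E3 →ₗ[ℝ] _)) ^ k := rfl

lemma ι_mem (a : E3) : ExteriorAlgebra.ι ℝ a ∈ ⋀[ℝ]^1 E3 := by
  rw [exteriorPower_eq, pow_one]; exact LinearMap.mem_range_self _ _

lemma vec_mem_grade (a : E3) : vec a ∈ grade 1 := by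
  rw [mem_grade, toExterior_vec]; exact ι_mem a

/-- The basis vectors are orthogonal, so all contraction terms vanish and `I3` corresponds to the
wedge of the three basis vectors. -/
lemma I3_mem_grade : I3 ∈ grade 3 := by
  have h : toExterior (vec (e 1) * vec (e 2)) =
      ExteriorAlgebra.ι ℝ (e 1) * ExteriorAlgebra.ι ℝ (e 2) := by
    rw [toExterior_vec_mul_vec, inner_e, if_neg (by decide), map_zero, add_zero]
  rw [mem_grade, I3, mul_assoc, toExterior_vec_mul, h]
  rw [show CliffordAlgebra.contractLeft (QuadraticMap.associated (R := ℝ) (-Q3) (e 0))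
    (ExteriorAlgebra.ι ℝ (e 1) * ExteriorAlgebra.ι ℝ (e 2)) = 0 from ?_, sub_zero,
    exteriorPower_eq, pow_succ', pow_succ', pow_one]
  · exact Submodule.mul_mem_mul (LinearMap.mem_range_self _ _)
      (Submodule.mul_mem_mul (LinearMap.mem_range_self _ _) (LinearMap.mem_range_self _ _))
  · refine (CliffordAlgebra.contractLeft_ι_mul (Q := (0 : QuadraticForm ℝ E3)) _ _ _).trans ?_
    rw [show CliffordAlgebra.contractLeft (QuadraticMap.associated (R := ℝ) (-Q3) (e 0))
      (ExteriorAlgebra.ι ℝ (e 2)) = _ from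
      CliffordAlgebra.contractLeft_ι (Q := (0 : QuadraticForm ℝ E3)) _ _]
    rw [associated_neg_Q3, associated_neg_Q3, inner_e, inner_e, if_neg (by decide),
      if_neg (by decide), neg_zero, zero_smul, map_zero, mul_zero, sub_zero]

/-- The bivector of two vectors, as the dual of the cross product. -/
lemma toExterior_I3_mul_vec_cross (a b : E3) :
    toExterior (I3 * vec (cross a b)) = ExteriorAlgebra.ι ℝ a * ExteriorAlgebra.ι ℝ b := by
  have h := congrArg toExterior (vec_mul_vec a b)
  rw [toExterior_vec_mul_vec, map_add,
    show toExterior (algebraMap ℝ G3 (inner ℝ a b)) = algebraMap ℝ _ (inner ℝ a b) from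
      CliffordAlgebra.changeForm_algebraMap
        CliffordAlgebra.changeForm.associated_neg_proof _, add_comm] at h
  exact (add_left_cancel h).symm

lemma exists_cross_eq_e (i : Fin 3) : ∃ a b : E3, e i = cross a b := by
  fin_cases i
  · exact ⟨e 1, e 2, by ext i; fin_cases i <;> simp [cross_apply, e]⟩
  · exact ⟨e 2, e 0, by ext i; fin_cases i <;> simp [cross_apply, e]⟩
  · exact ⟨e 0, e 1, by ext i; fin_cases i <;> simp [cross_apply, e]⟩

/-- Each `e i` is a cross product `a × b`, and `I (a × b)` corresponds to the wedge of `a` and `b`;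
the rest is linearity. -/
lemma I3_mul_vec_mem_grade (b : E3) : I3 * vec b ∈ grade 2 := by
  have key : ∀ i, I3 * vec (e i) ∈ grade 2 := by
    intro i
    obtain ⟨a, b, h⟩ := exists_cross_eq_e i
    rw [h, mem_grade, toExterior_I3_mul_vec_cross, exteriorPower_eq, pow_two]
    exact Submodule.mul_mem_mul (LinearMap.mem_range_self _ _) (LinearMap.mem_range_self _ _)
  rw [vec_eq_sum]
  simp only [mul_add, mul_smul_comm]
  exact add_mem (add_mem (Submodule.smul_mem _ _ (key 0)) (Submodule.smul_mem _ _ (key 1)))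
    (Submodule.smul_mem _ _ (key 2))

/-- Every bivector is the dual of a vector. -/
lemma exists_eq_I3_mul_vec {A : G3} (h : A ∈ grade 2) : ∃ b, A = I3 * vec b := by
  suffices H : ∀ y ∈ ⋀[ℝ]^2 E3, ∃ b, y = toExterior (I3 * vec b) by
    obtain ⟨b, hb⟩ := H _ (mem_grade.1 h)
    exact ⟨b, toExterior.injective hb⟩
  intro y hy
  rw [exteriorPower_eq, pow_two] at hy
  refine Submodule.mul_induction_on hy ?_ ?_
  · rintro _ ⟨a, rfl⟩ _ ⟨b, rfl⟩
    exact ⟨cross a b, (toExterior_I3_mul_vec_cross a b).symm⟩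
  · rintro _ _ ⟨a, rfl⟩ ⟨b, rfl⟩
    exact ⟨a + b, by rw [map_add, mul_add, map_add]⟩

/-! ### Products with dual vectors -/

lemma dot_I3_vec (c : E3) : dot I3 (vec c) = I3 * vec c := by
  rw [dot_of_mem I3_mem_grade (vec_mem_grade c) (by decide) (by decide)]
  exact gradePart_of_mem (I3_mul_vec_mem_grade c)

/-- Since `I` is central with square `-1`, `a (I b) = I (a b) = (a · b) I - a × b`. The inner
product of grades one and two keeps only the vector part. -/
lemma dot_vec_I3_mul_vec (a b : E3) : dot (vec a) (I3 * vec b) = -vec (cross a b) := by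
  have h : vec a * (I3 * vec b) = (inner ℝ a b : ℝ) • I3 - vec (cross a b) := by
    rw [← mul_assoc, vec_mul_I3, mul_assoc, vec_mul_vec, mul_add, ← mul_assoc I3 I3, I3_mul_I3,
      ← Algebra.commutes, ← Algebra.smul_def, neg_one_mul, sub_eq_add_neg]
  rw [dot_of_mem (vec_mem_grade a) (I3_mul_vec_mem_grade b) (by decide) (by decide), h, map_sub,
    map_smul, gradePart_of_mem (vec_mem_grade _), gradePart_of_mem_ne I3_mem_grade (by decide),
    smul_zero, zero_sub]

/-- Here `(I a)(I b) = -a b`, and the antisymmetric part of `a b` is `I (a × b)`; the sign is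
absorbed by swapping the factors. -/
lemma comm_I3_mul_vec (a b : E3) :
    comm (I3 * vec a) (I3 * vec b) = I3 * vec (cross b a) := by
  have h (a b : E3) : I3 * vec a * (I3 * vec b) = -(vec a * vec b) := by
    rw [mul_assoc, ← mul_assoc (vec a), vec_mul_I3, mul_assoc, ← mul_assoc, I3_mul_I3,
      neg_one_mul]
  rw [comm, h, h, vec_mul_vec, vec_mul_vec, cross_swap b a, map_neg, mul_neg, real_inner_comm]
  module

/-- The linear left inverse of `vec`. -/
def unvec : G3 →ₗ[ℝ] E3 := ExteriorAlgebra.ιInv ∘ₗ toExterior.toLinearMap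

lemma unvec_vec (a : E3) : unvec (vec a) = a := by
  simp only [unvec, LinearMap.comp_apply, LinearEquiv.coe_coe, toExterior_vec]
  exact ExteriorAlgebra.ι_leftInverse (R := ℝ) (M := E3) a

/-- The vector `b` with `A = I b`, for a bivector `A`. -/
def dualVec : G3 →ₗ[ℝ] E3 := unvec ∘ₗ LinearMap.mulLeft ℝ (-I3)

/-- The dual `I b` of a vector `b`. -/
def dualBivec : E3 →ₗ[ℝ] G3 := LinearMap.mulLeft ℝ I3 ∘ₗ vec

lemma dualVec_I3_mul_vec (b : E3) : dualVec (I3 * vec b) = b := by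
  simp [dualVec, ← mul_assoc, I3_mul_I3, unvec_vec]

lemma I3_mul_vec_dualVec {A : G3} (h : A ∈ grade 2) : I3 * vec (dualVec A) = A := by
  obtain ⟨b, rfl⟩ := exists_eq_I3_mul_vec h
  rw [dualVec_I3_mul_vec]

/-- The cross product as a bilinear map. -/
def crossₗ : E3 →ₗ[ℝ] E3 →ₗ[ℝ] E3 :=
  LinearMap.mk₂ ℝ cross (by intros; simp [cross]) (by intros; simp [cross])
    (by intros; simp [cross]) (by intros; simp [cross])

lemma crossₗ_apply (a b : E3) : crossₗ a b = cross a b := rfl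

instance : FiniteDimensional ℝ G3 := Module.Basis.finiteDimensional_of_finite bladeBasis

open Set Filter Metric Module

/-! ### Fields of class C¹ up to the boundary -/

section UpToBoundary

variable {E : Type*} [NormedAddCommGroup E] [NormedSpace ℝ E]
  {W : Type*} [NormedAddCommGroup W] [NormedSpace ℝ W] {M : Set E} {f : E → W}

/-- `f` is continuous on `M` and has a bounded continuous derivative in the interior of `M`. -/
structure IsC1UpTo (M : Set E) (f : E → W) : Prop where
  continuousOn : ContinuousOn f M
  differentiableAt : ∀ x ∈ interior M, DifferentiableAt ℝ f x
  continuousOn_fderiv : ContinuousOn (fderiv ℝ f) (interior M)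
  bounded_fderiv : ∃ C, ∀ x ∈ interior M, ‖fderiv ℝ f x‖ ≤ C

/-- Only the bound needs an argument. Near each point of `M`, boundary points included, there is a
derivative along a relative neighbourhood that is continuous at the point, hence bounded nearby; at
interior points it coincides with `fderiv`. Compactness makes the bound uniform. -/
lemma isC1UpTo_of_contDiffOn (hM : IsCompact M) (hf : ContDiffOn ℝ 1 f M) : IsC1UpTo M f := by
  have hint : ContDiffOn ℝ 1 f (interior M) := hf.mono interior_subset
  refine ⟨hf.continuousOn, fun x hx => ?_, hint.continuousOn_fderiv_of_isOpen isOpen_interior le_rfl,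
    ?_⟩
  · exact (hint.differentiableOn one_ne_zero).differentiableAt (isOpen_interior.mem_nhds hx)
  · suffices H : ∃ C, ∀ x ∈ M ∩ interior M, ‖fderiv ℝ f x‖ ≤ C by
      obtain ⟨C, hC⟩ := H
      exact ⟨C, fun x hx => hC x ⟨interior_subset hx, hx⟩⟩
    refine hM.induction_on (p := fun s => ∃ C, ∀ x ∈ s ∩ interior M, ‖fderiv ℝ f x‖ ≤ C)
      ⟨0, by simp⟩ ?_ ?_ ?_
    · rintro s t hst ⟨C, hC⟩
      exact ⟨C, fun x hx => hC x ⟨hst hx.1, hx.2⟩⟩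
    · rintro s t ⟨C, hC⟩ ⟨D, hD⟩
      refine ⟨max C D, fun x hx => ?_⟩
      rcases hx.1 with h | h
      · exact (hC x ⟨h, hx.2⟩).trans (le_max_left _ _)
      · exact (hD x ⟨h, hx.2⟩).trans (le_max_right _ _)
    · intro x hx
      have h := hf x hx
      rw [show (1 : WithTop ℕ∞) = 0 + 1 from (zero_add _).symm,
        contDiffWithinAt_succ_iff_hasFDerivWithinAt (by simp)] at h
      obtain ⟨u, hu, -, f', hf', hcont⟩ := h
      rw [insert_eq_of_mem hx] at hu
      have hc : ContinuousWithinAt (fun y => ‖f' y‖) u x := hcont.continuousWithinAt.norm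
      have h1 : ∀ᶠ y in 𝓝[M] x, ‖f' y‖ < ‖f' x‖ + 1 :=
        (hc.eventually_lt_const (lt_add_one _)).filter_mono (nhdsWithin_le_iff.2 hu)
      -- For `y` in the interior of `M` this makes `u` a full neighbourhood of `y`, so the
      -- derivative within `u` is the ordinary one.
      have h2 : ∀ᶠ y in 𝓝[M] x, u ∈ 𝓝[M] y := eventually_eventually_nhdsWithin.2 hu
      refine ⟨_, h1.and h2, ‖f' x‖ + 1, ?_⟩
      rintro y ⟨⟨hy1, hy2⟩, hy⟩
      have hyu : u ∈ 𝓝 y := by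
        rwa [nhdsWithin_eq_nhds.2 (mem_interior_iff_mem_nhds.1 hy)] at hy2
      rw [((hf' y (mem_of_mem_nhds hyu)).hasFDerivAt hyu).fderiv]
      exact hy1.le

namespace IsC1UpTo

lemma bounded (hf : IsC1UpTo M f) (hM : IsCompact M) : ∃ C, 0 ≤ C ∧ ∀ x ∈ M, ‖f x‖ ≤ C := by
  obtain ⟨C, hC⟩ := hM.exists_bound_of_continuousOn hf.continuousOn
  exact ⟨max C 0, le_max_right _ _, fun x hx => (hC x hx).trans (le_max_left _ _)⟩

lemma fderiv_smul_apply (hf : IsC1UpTo M f) {u : E → ℝ} (hu : ContDiff ℝ 1 u) {x : E}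
    (hx : x ∈ interior M) (v : E) :
    fderiv ℝ (fun y => u y • f y) x v = u x • fderiv ℝ f x v + fderiv ℝ u x v • f x := by
  rw [fderiv_fun_smul (hu.differentiable one_ne_zero x) (hf.differentiableAt x hx)]
  simp

lemma smul (hf : IsC1UpTo M f) (hM : IsCompact M) {u : E → ℝ} (hu : ContDiff ℝ 1 u) :
    IsC1UpTo M (fun x => u x • f x) := by
  have hd : ∀ x ∈ interior M, fderiv ℝ (fun y => u y • f y) x =
      u x • fderiv ℝ f x + (fderiv ℝ u x).smulRight (f x) := fun x hx =>
    fderiv_fun_smul (hu.differentiable one_ne_zero x) (hf.differentiableAt x hx)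
  have hu' : Continuous (fderiv ℝ u) := hu.continuous_fderiv one_ne_zero
  refine ⟨hu.continuous.continuousOn.smul hf.continuousOn, fun x hx =>
    (hu.differentiable one_ne_zero x).smul (hf.differentiableAt x hx), ?_, ?_⟩
  · refine ContinuousOn.congr ?_ hd
    refine (hu.continuous.continuousOn.smul hf.continuousOn_fderiv).add ?_
    have := (ContinuousLinearMap.smulRightL ℝ E W).continuous₂.comp_continuousOn
      (hu'.continuousOn.prodMk (hf.continuousOn.mono interior_subset))
    exact this
  · obtain ⟨A, hA⟩ := hM.exists_bound_of_continuousOn hu.continuous.continuousOn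
    obtain ⟨B, hB⟩ := hM.exists_bound_of_continuousOn hu'.continuousOn
    obtain ⟨C, hC⟩ := hf.bounded_fderiv
    obtain ⟨D, hD0, hD⟩ := hf.bounded hM
    refine ⟨A * C + B * D, fun x hx => ?_⟩
    have hxM := interior_subset hx
    have hA0 := (norm_nonneg _).trans (hA x hxM)
    have hB0 := (norm_nonneg _).trans (hB x hxM)
    rw [hd x hx]
    refine (norm_add_le _ _).trans (add_le_add ?_ ?_)
    · rw [norm_smul]
      exact mul_le_mul (hA x hxM) (hC x hx) (norm_nonneg _) hA0
    · rw [ContinuousLinearMap.norm_smulRight_apply]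
      exact mul_le_mul (hB x hxM) (hD x hxM) (norm_nonneg _) hB0

variable [MeasurableSpace E] [BorelSpace E] [FiniteDimensional ℝ E] {μ : Measure E}
  [IsFiniteMeasureOnCompacts μ]

omit [FiniteDimensional ℝ E] in
lemma integrableOn (hf : IsC1UpTo M f) (hM : IsCompact M) : IntegrableOn f (interior M) μ :=
  (hf.continuousOn.integrableOn_compact hM).mono_set interior_subset

lemma integrableOn_fderiv (hf : IsC1UpTo M f) (hM : IsCompact M) (v : E) :
    IntegrableOn (fun x => fderiv ℝ f x v) (interior M) μ := by
  obtain ⟨C, hC⟩ := hf.bounded_fderiv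
  refine IntegrableOn.of_bound
    ((measure_mono interior_subset).trans_lt hM.measure_lt_top) ?_ (C * ‖v‖) ?_
  · exact (hf.continuousOn_fderiv.clm_apply continuousOn_const).aestronglyMeasurable
      isOpen_interior.measurableSet
  · refine (ae_restrict_iff' isOpen_interior.measurableSet).2 (Eventually.of_forall fun x hx => ?_)
    exact ((fderiv ℝ f x).le_opNorm v).trans (by gcongr; exact hC x hx)

/-- The integral of a partial derivative of a field supported in the interior vanishes. -/
lemma integral_fderiv_smul_eq_zero {μ : Measure E} [μ.IsAddHaarMeasure]
    (hf : IsC1UpTo M f) (hM : IsCompact M) {u : E → ℝ}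
    (hu : ContDiff ℝ 1 u) (hsupp : tsupport u ⊆ interior M) (v : E) :
    ∫ x in interior M, fderiv ℝ (fun y => u y • f y) x v ∂μ = 0 := by
  have hu0 : ∀ x ∉ interior M, u x = 0 := fun x hx =>
    image_eq_zero_of_notMem_tsupport fun h => hx (hsupp h)
  have hdu0 : ∀ x ∉ interior M, fderiv ℝ u x = 0 := fun x hx =>
    image_eq_zero_of_notMem_tsupport fun h => hx (hsupp (tsupport_fderiv_subset ℝ h))
  have hu' : Continuous (fderiv ℝ u) := hu.continuous_fderiv one_ne_zero
  have i1 : IntegrableOn (fun x => fderiv ℝ u x v • f x) (interior M) μ := by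
    have : ContinuousOn (fun x => fderiv ℝ u x v • f x) M :=
      (hu'.clm_apply continuous_const).continuousOn.smul hf.continuousOn
    exact (this.integrableOn_compact hM).mono_set interior_subset
  -- By the product rule this term is the derivative of `u • f` minus the term in `i1`.
  have i2 : IntegrableOn (fun x => u x • fderiv ℝ f x v) (interior M) μ := by
    refine (((hf.smul hM hu).integrableOn_fderiv hM v (μ := μ)).sub i1).congr_fun ?_
      isOpen_interior.measurableSet
    intro x hx
    simp [hf.fderiv_smul_apply hu hx]
  have i3 : IntegrableOn (fun x => u x • f x) (interior M) μ := (hf.smul hM hu).integrableOn hM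
  have s1 : ∀ x ∉ interior M, fderiv ℝ u x v • f x = 0 := fun x hx => by simp [hdu0 x hx]
  have s2 : ∀ x ∉ interior M, u x • fderiv ℝ f x v = 0 := fun x hx => by simp [hu0 x hx]
  have s3 : ∀ x ∉ interior M, u x • f x = 0 := fun x hx => by simp [hu0 x hx]
  have hsub {g : E → W} (h : ∀ x ∉ interior M, g x = 0) : Function.support g ⊆ interior M :=
    fun x hx => by_contra fun hx' => hx (h x hx')
  -- Integration by parts on the whole space. The products vanish outside `interior M`, and `f` need
  -- only be differentiable on the support of `u`.
  have key := integral_smul_fderiv_eq_neg_fderiv_smul_of_integrable (f := u) (g := f) (v := v)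
    ((integrableOn_iff_integrable_of_support_subset (hsub s1)).1 i1)
    ((integrableOn_iff_integrable_of_support_subset (hsub s2)).1 i2)
    ((integrableOn_iff_integrable_of_support_subset (hsub s3)).1 i3)
    (fun x _ => hu.differentiable one_ne_zero x) (fun x hx => hf.differentiableAt x (hsupp hx))
  rw [setIntegral_congr_fun isOpen_interior.measurableSet
    (fun x hx => hf.fderiv_smul_apply hu hx v), integral_add i2 i1,
    setIntegral_eq_integral_of_forall_compl_eq_zero s1,
    setIntegral_eq_integral_of_forall_compl_eq_zero s2, key, neg_add_cancel]

end IsC1UpTo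

lemma isC1UpTo_const (M : Set E) (c : W) : IsC1UpTo M (fun _ => c) := by
  refine ⟨continuousOn_const, fun x _ => differentiableAt_const c, ?_, 0, fun x _ => ?_⟩
  · simp only [fderiv_fun_const]; exact continuousOn_const
  · simp

end UpToBoundary

/-! ### Cutoffs near sets of zero area -/

section Cutoff

variable {E : Type*} [NormedAddCommGroup E] [NormedSpace ℝ E] [MeasurableSpace E] [BorelSpace E]

omit [NormedSpace ℝ E] in
/-- A compact set of vanishing two-dimensional Hausdorff measure is covered by finitely many balls
with a small sum of squared radii. -/
lemma exists_finite_ball_cover {S : Set E} (hS : IsCompact S) (h0 : μH[2] S = 0) {ε : ℝ}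
    (hε : 0 < ε) : ∃ (J : Finset ℕ) (x : ℕ → E) (r : ℕ → ℝ),
      (∀ n ∈ J, x n ∈ S ∧ 0 < r n) ∧ S ⊆ ⋃ n ∈ J, ball (x n) (r n) ∧ ∑ n ∈ J, r n ^ 2 ≤ ε := by
  -- The radii will be `diam + a`, with `(diam + a)² ≤ 2 diam² + 2 a²`; both sums of squares are at
  -- most `ε'`, whence the factor 4. The cap 1 gives `a ≤ 1`, hence `a² ≤ a`.
  set ε' : ℝ := min (ε / 4) 1 with hε'
  have hε'0 : 0 < ε' := by positivity
  -- The Hausdorff measure is the supremum over scales of such infima; scale 1 suffices and keeps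
  -- the diameters finite.
  have h1 : ⨅ (t : ℕ → Set E) (_ : S ⊆ ⋃ n, t n) (_ : ∀ n, ediam (t n) ≤ 1),
      ∑' n, ⨆ (_ : (t n).Nonempty), ediam (t n) ^ (2 : ℝ) < ENNReal.ofReal ε' := by
    refine lt_of_le_of_lt ?_ (ENNReal.ofReal_pos.2 hε'0)
    rw [← h0, Measure.hausdorffMeasure_apply]
    exact le_iSup₂_of_le (1 : ENNReal) one_pos le_rfl
  simp only [iInf_lt_iff] at h1
  obtain ⟨t, hSt, hdiam, hsum⟩ := h1
  obtain ⟨a, ha0, hasum⟩ := ENNReal.exists_pos_sum_of_countable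
    (ENNReal.ofReal_pos.2 hε'0).ne' ℕ
  have hfin : ∀ n, ediam (t n) ≠ ⊤ := fun n => ne_top_of_le_ne_top ENNReal.one_ne_top (hdiam n)
  have hex : ∀ n, ∃ y, (t n ∩ S).Nonempty → y ∈ t n ∩ S := fun n => by
    by_cases h : (t n ∩ S).Nonempty
    · exact ⟨h.some, fun _ => h.some_mem⟩
    · exact ⟨0, fun h' => absurd h' h⟩
  choose x hx using hex
  -- The positive summand `a n` makes the open ball contain the whole piece, even one of diameter
  -- zero.
  let r : ℕ → ℝ := fun n => (ediam (t n)).toReal + a n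
  have hr : ∀ n, 0 < r n := fun n => add_pos_of_nonneg_of_pos ENNReal.toReal_nonneg (ha0 n)
  let U : {n // (t n ∩ S).Nonempty} → Set E := fun n => ball (x n) (r n)
  obtain ⟨J, hJ⟩ := hS.elim_finite_subcover U (fun n => isOpen_ball) (fun y hy => by
    obtain ⟨n, hn⟩ := mem_iUnion.1 (hSt hy)
    have hne : (t n ∩ S).Nonempty := ⟨y, hn, hy⟩
    refine mem_iUnion.2 ⟨⟨n, hne⟩, ?_⟩
    have hd : edist y (x n) ≤ ediam (t n) := edist_le_ediam_of_mem hn (hx n hne).1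
    rw [mem_ball, dist_edist]
    exact (ENNReal.toReal_mono (hfin n) hd).trans_lt (lt_add_of_pos_right _ (ha0 n)))
  have hJne : ∀ n ∈ J.map (Function.Embedding.subtype _), (t n ∩ S).Nonempty := by
    intro n hn
    obtain ⟨m, -, rfl⟩ := Finset.mem_map.1 hn
    exact m.2
  refine ⟨J.map (Function.Embedding.subtype _), x, r, fun n hn => ⟨(hx n (hJne n hn)).2, hr n⟩,
    ?_, ?_⟩
  · intro y hy
    obtain ⟨n, hn, hyn⟩ := mem_iUnion₂.1 (hJ hy)
    exact mem_iUnion₂.2 ⟨n, Finset.mem_map.2 ⟨n, hn, rfl⟩, hyn⟩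
  · set J' := J.map (Function.Embedding.subtype fun n => (t n ∩ S).Nonempty)
    have e1 : ∑ n ∈ J', (ediam (t n)).toReal ^ 2 ≤ ε' := by
      rw [← ENNReal.ofReal_le_ofReal_iff hε'0.le,
        ENNReal.ofReal_sum_of_nonneg (fun _ _ => sq_nonneg _)]
      refine le_trans ?_ ((ENNReal.sum_le_tsum J').trans hsum.le)
      refine Finset.sum_le_sum fun n hn => ?_
      refine le_iSup_of_le ((hJne n hn).mono inter_subset_left) ?_
      rw [ENNReal.ofReal_pow ENNReal.toReal_nonneg, ENNReal.ofReal_toReal (hfin n),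
        ← ENNReal.rpow_natCast]
      norm_num
    have e2' : ∑ n ∈ J', (a n : ℝ) ≤ ε' := by
      rw [← ENNReal.ofReal_le_ofReal_iff hε'0.le, ENNReal.ofReal_sum_of_nonneg (fun _ _ => by simp)]
      refine le_trans ?_ ((ENNReal.sum_le_tsum J').trans hasum.le)
      simp
    have e2 : ∑ n ∈ J', (a n : ℝ) ^ 2 ≤ ε' := by
      refine le_trans (Finset.sum_le_sum fun n hn => ?_) e2'
      have h1 : (a n : ℝ) ≤ 1 := (Finset.single_le_sum (f := fun n => (a n : ℝ))
        (fun i _ => (a i).2) hn).trans (e2'.trans (min_le_right _ _))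
      have h0 : (0 : ℝ) ≤ a n := (a n).2
      nlinarith
    calc ∑ n ∈ J', r n ^ 2 ≤ ∑ n ∈ J', (2 * (ediam (t n)).toReal ^ 2 + 2 * (a n : ℝ) ^ 2) :=
          Finset.sum_le_sum fun n _ => by
            simp only [r]; nlinarith [sq_nonneg ((ediam (t n)).toReal - a n)]
      _ = 2 * ∑ n ∈ J', (ediam (t n)).toReal ^ 2 + 2 * ∑ n ∈ J', (a n : ℝ) ^ 2 := by
          rw [Finset.sum_add_distrib, Finset.mul_sum, Finset.mul_sum]
      _ ≤ 4 * ε' := by linarith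
      _ ≤ ε := by have := min_le_left (ε / 4) 1; linarith

omit [MeasurableSpace E] [BorelSpace E] in
-- In the Leibniz rule every undifferentiated factor lies in `[0, 1]`.
lemma norm_fderiv_prod_le {ι : Type*} (J : Finset ι) (a : ι → E → ℝ)
    (hd : ∀ n, Differentiable ℝ (a n)) (h0 : ∀ n x, 0 ≤ a n x) (h1 : ∀ n x, a n x ≤ 1) (x : E) :
    ‖fderiv ℝ (fun y => ∏ n ∈ J, a n y) x‖ ≤ ∑ n ∈ J, ‖fderiv ℝ (a n) x‖ := by
  classical
  induction J using Finset.induction_on with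
  | empty => simp
  | insert n J hn ih =>
    simp only [Finset.prod_insert hn, Finset.sum_insert hn]
    have hp : DifferentiableAt ℝ (fun y => ∏ n ∈ J, a n y) x :=
      (HasFDerivAt.finsetProd fun n _ => (hd n x).hasFDerivAt).differentiableAt
    rw [fderiv_fun_mul (hd n x) hp, add_comm]
    have hP0 : 0 ≤ ∏ n ∈ J, a n x := Finset.prod_nonneg fun n _ => h0 n x
    have hP1 : ∏ n ∈ J, a n x ≤ 1 := Finset.prod_le_one (fun n _ => h0 n x) fun n _ => h1 n x
    refine (norm_add_le _ _).trans (add_le_add ?_ ?_)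
    · rw [norm_smul, Real.norm_of_nonneg hP0]
      exact mul_le_of_le_one_left (norm_nonneg _) hP1
    · rw [norm_smul, Real.norm_of_nonneg (h0 n x)]
      exact (mul_le_of_le_one_left (norm_nonneg _) (h1 n x)).trans ih

/-- A smooth function that vanishes near a compact set of vanishing two-dimensional Hausdorff
measure, is one away from it, and has a gradient of small integral. -/
lemma exists_cutoff [FiniteDimensional ℝ E] (hE : finrank ℝ E = 3) (μ : Measure E)
    [μ.IsAddHaarMeasure] {S : Set E} (hS : IsCompact S) (h0 : μH[2] S = 0) {ε : ℝ} (hε : 0 < ε) :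
    ∃ η : E → ℝ, ContDiff ℝ 1 η ∧ (∀ x, 0 ≤ η x) ∧ (∀ x, η x ≤ 1) ∧ Disjoint (tsupport η) S ∧
      (∀ x ∉ cthickening ε S, η x = 1) ∧ ∫⁻ x, ‖fderiv ℝ η x‖ₑ ∂μ ≤ ENNReal.ofReal ε := by
  let β : ContDiffBump (0 : E) := ⟨1, 2, one_pos, one_lt_two⟩
  have hβ : ContDiff ℝ 1 β := β.contDiff
  obtain ⟨C, hC⟩ := (hβ.continuous_fderiv one_ne_zero).bounded_above_of_compact_support
    (β.hasCompactSupport.fderiv (𝕜 := ℝ))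
  have hC0 : 0 ≤ C := (norm_nonneg _).trans (hC 0)
  set V : ℝ := (μ (ball 0 1)).toReal
  have hV : μ (ball 0 1) = ENNReal.ofReal V := (ENNReal.ofReal_toReal measure_ball_lt_top.ne).symm
  have hV0 : 0 ≤ V := ENNReal.toReal_nonneg
  -- One bump of radius `r` has gradient at most `C / r`, carried by a ball of volume `(2 r)³ V`, so
  -- its gradient has integral at most `8 C V r²`. The summand 1 makes `K` positive.
  set K : ℝ := 8 * C * V + 1
  have hK : 0 < K := by positivity
  -- The first bound forces `2 r ≤ ε`, so that the cutoff is one outside the `ε`-thickening; the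
  -- second controls the integral of the gradient.
  obtain ⟨J, c, r, hcr, hcov, hsum⟩ := exists_finite_ball_cover hS h0
    (show 0 < min ((ε / 2) ^ 2) (ε / K) by positivity)
  have hr : ∀ n ∈ J, 2 * r n ≤ ε := by
    intro n hn
    have h1 : r n ^ 2 ≤ (ε / 2) ^ 2 :=
      (Finset.single_le_sum (f := fun n => r n ^ 2) (fun _ _ => sq_nonneg _) hn).trans
        (hsum.trans (min_le_left _ _))
    have := abs_le_of_sq_le_sq h1 (by positivity)
    linarith [le_abs_self (r n)]
  -- Zero on the ball of radius `r n` and one beyond radius `2 r n`; the product over `J` is the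
  -- cutoff.
  let a : ℕ → E → ℝ := fun n y => 1 - β ((r n)⁻¹ • (y - c n))
  have ha : ∀ n, ContDiff ℝ 1 (a n) := fun n =>
    contDiff_const.sub (hβ.comp (contDiff_const.smul (contDiff_id.sub contDiff_const)))
  have ha0 : ∀ n x, 0 ≤ a n x := fun n x => sub_nonneg.2 β.le_one
  have ha1 : ∀ n x, a n x ≤ 1 := fun n x => sub_le_self _ β.nonneg
  have hone : ∀ n ∈ J, ∀ x, 2 * r n ≤ dist x (c n) → a n x = 1 := by
    intro n hn x hx
    have : β ((r n)⁻¹ • (x - c n)) = 0 := β.zero_of_le_dist (by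
      rw [dist_zero_right, norm_smul, norm_inv, Real.norm_of_nonneg (hcr n hn).2.le, ← dist_eq_norm]
      change 2 ≤ _
      rw [inv_mul_eq_div, le_div_iff₀ (hcr n hn).2]
      exact hx)
    simp [a, this]
  have hzero : ∀ n ∈ J, ∀ x ∈ ball (c n) (r n), a n x = 0 := by
    intro n hn x hx
    have : β ((r n)⁻¹ • (x - c n)) = 1 := β.one_of_mem_closedBall (by
      rw [mem_closedBall_zero_iff, norm_smul, norm_inv, Real.norm_of_nonneg (hcr n hn).2.le,
        ← dist_eq_norm]
      change _ ≤ 1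
      rw [inv_mul_eq_div, div_le_one (hcr n hn).2]
      exact (mem_ball.1 hx).le)
    simp [a, this]
  have hgrad : ∀ n ∈ J, ∀ x, ‖fderiv ℝ (a n) x‖ ≤ C / r n := by
    intro n hn x
    have h1 : HasFDerivAt (fun y : E => (r n)⁻¹ • (y - c n))
        ((r n)⁻¹ • ContinuousLinearMap.id ℝ E) x :=
      ((hasFDerivAt_id x).sub_const (c n)).const_smul (r n)⁻¹
    have h2 := (((hβ.differentiable one_ne_zero _).hasFDerivAt.comp x h1).const_sub 1).fderiv
    change ‖fderiv ℝ (fun y => 1 - β ((r n)⁻¹ • (y - c n))) x‖ ≤ _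
    rw [show fderiv ℝ (fun y => 1 - β ((r n)⁻¹ • (y - c n))) x = _ from h2, norm_neg,
      ContinuousLinearMap.comp_smul, norm_smul, norm_inv, Real.norm_of_nonneg (hcr n hn).2.le,
      inv_mul_eq_div, ContinuousLinearMap.comp_id]
    exact div_le_div_of_nonneg_right (hC _) (hcr n hn).2.le
  have hgrad0 : ∀ n ∈ J, ∀ x ∉ closedBall (c n) (2 * r n), fderiv ℝ (a n) x = 0 := by
    intro n hn x hx
    have : a n =ᶠ[𝓝 x] fun _ => 1 := by
      filter_upwards [isClosed_closedBall.isOpen_compl.mem_nhds hx] with y hy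
      exact hone n hn y (not_le.1 fun h => hy (mem_closedBall.2 h)).le
    rw [this.fderiv_eq, fderiv_fun_const]; rfl
  have hint : ∀ n ∈ J, ∫⁻ x, ‖fderiv ℝ (a n) x‖ₑ ∂μ ≤ ENNReal.ofReal (8 * C * V * r n ^ 2) := by
    intro n hn
    have hrn := (hcr n hn).2
    calc ∫⁻ x, ‖fderiv ℝ (a n) x‖ₑ ∂μ
        ≤ ∫⁻ x, (closedBall (c n) (2 * r n)).indicator (fun _ => ENNReal.ofReal (C / r n)) x ∂μ := by
          refine lintegral_mono fun x => ?_
          by_cases hx : x ∈ closedBall (c n) (2 * r n)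
          · rw [indicator_of_mem hx, ← ofReal_norm]
            exact ENNReal.ofReal_le_ofReal (hgrad n hn x)
          · have : ‖fderiv ℝ (a n) x‖ = 0 := norm_eq_zero.2 (hgrad0 n hn x hx)
            rw [← ofReal_norm, this, ENNReal.ofReal_zero]
            exact zero_le
      _ = ENNReal.ofReal (C / r n) * μ (closedBall (c n) (2 * r n)) := by
          rw [lintegral_indicator_const isClosed_closedBall.measurableSet]
      _ = ENNReal.ofReal (8 * C * V * r n ^ 2) := by
          rw [Measure.addHaar_closedBall μ _ (by positivity), hE, hV,
            ← ENNReal.ofReal_mul (by positivity), ← ENNReal.ofReal_mul (by positivity)]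
          congr 1
          field_simp
          ring
  refine ⟨fun x => ∏ n ∈ J, a n x, contDiff_prod fun n _ => ha n,
    fun x => Finset.prod_nonneg fun n _ => ha0 n x,
    fun x => Finset.prod_le_one (fun n _ => ha0 n x) fun n _ => ha1 n x, ?_, ?_, ?_⟩
  · rw [Set.disjoint_right]
    intro x hx
    obtain ⟨n, hn, hxn⟩ := mem_iUnion₂.1 (hcov hx)
    rw [notMem_tsupport_iff_eventuallyEq]
    filter_upwards [isOpen_ball.mem_nhds hxn] with y hy
    exact Finset.prod_eq_zero hn (hzero n hn y hy)
  · intro x hx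
    refine Finset.prod_eq_one fun n hn => hone n hn x ?_
    by_contra! h
    exact hx (mem_cthickening_of_dist_le x (c n) ε S (hcr n hn).1 (h.le.trans (hr n hn)))
  · calc ∫⁻ x, ‖fderiv ℝ (fun x => ∏ n ∈ J, a n x) x‖ₑ ∂μ
        ≤ ∫⁻ x, ∑ n ∈ J, ‖fderiv ℝ (a n) x‖ₑ ∂μ := by
          refine lintegral_mono fun x => ?_
          have := norm_fderiv_prod_le J a (fun n => (ha n).differentiable one_ne_zero) ha0 ha1 x
          simp_rw [← ofReal_norm]
          rw [← ENNReal.ofReal_sum_of_nonneg fun _ _ => norm_nonneg _]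
          exact ENNReal.ofReal_le_ofReal this
      _ = ∑ n ∈ J, ∫⁻ x, ‖fderiv ℝ (a n) x‖ₑ ∂μ :=
          lintegral_finsetSum' _ fun n _ =>
            ((ha n).continuous_fderiv one_ne_zero).enorm.measurable.aemeasurable
      _ ≤ ∑ n ∈ J, ENNReal.ofReal (8 * C * V * r n ^ 2) := Finset.sum_le_sum hint
      _ = ENNReal.ofReal (8 * C * V * ∑ n ∈ J, r n ^ 2) := by
          rw [← ENNReal.ofReal_sum_of_nonneg fun n _ => by positivity, Finset.mul_sum]
      _ ≤ ENNReal.ofReal ε := by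
          refine ENNReal.ofReal_le_ofReal ?_
          have h1 : ∑ n ∈ J, r n ^ 2 ≤ ε / K := hsum.trans (min_le_right _ _)
          calc 8 * C * V * ∑ n ∈ J, r n ^ 2 ≤ K * (ε / K) := by
                refine mul_le_mul (by simp [K]) h1 (Finset.sum_nonneg fun _ _ => sq_nonneg _) hK.le
            _ = ε := mul_div_cancel₀ ε hK.ne'

end Cutoff

/-! ### Boundary graphs over a hyperplane -/

section FlatChart

variable {E : Type*} [NormedAddCommGroup E] [InnerProductSpace ℝ E]

/-- The hyperplane through the origin with normal `N`. -/
abbrev Hyp (N : E) : Submodule ℝ E := (ℝ ∙ N)ᗮ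

/-- The point at height `t` in direction `N` over the point `y` of the hyperplane through `x`. -/
def graphPt (x N : E) (t : ℝ) (y : Hyp N) : E := x + t • N + y

/-- The cylinder of radius and half-height `r` around `x` in direction `N`. -/
def cylinder (x N : E) (r : ℝ) : Set E :=
  {p | |inner ℝ N (p - x)| < r ∧ ‖(Hyp N).orthogonalProjectionOnto (p - x)‖ < r}

lemma isOpen_cylinder (x N : E) (r : ℝ) : IsOpen (cylinder x N r) := by
  have h1 : Continuous fun p => |inner ℝ N (p - x)| := by fun_prop
  have h2 : Continuous fun p => ‖(Hyp N).orthogonalProjectionOnto (p - x)‖ := by fun_prop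
  exact (isOpen_lt h1 continuous_const).inter (isOpen_lt h2 continuous_const)

lemma mem_cylinder_self (x N : E) {r : ℝ} (hr : 0 < r) : x ∈ cylinder x N r := by
  simp [cylinder, hr]

variable {x N : E}

lemma inner_Hyp (y : Hyp N) : inner ℝ N (y : E) = 0 :=
  (Submodule.mem_orthogonal_singleton_iff_inner_right).1 y.2

lemma inner_graphPt (hN : ‖N‖ = 1) (t : ℝ) (y : Hyp N) :
    inner ℝ N (graphPt x N t y - x) = t := by
  rw [show graphPt x N t y - x = t • N + y by simp [graphPt, add_assoc], inner_add_right,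
    inner_Hyp, real_inner_smul_right, real_inner_self_eq_norm_sq, hN]
  simp

lemma proj_graphPt (t : ℝ) (y : Hyp N) :
    (Hyp N).orthogonalProjectionOnto (graphPt x N t y - x) = y := by
  rw [show graphPt x N t y - x = t • N + y by simp [graphPt, add_assoc], map_add, map_smul]
  have : (Hyp N).orthogonalProjectionOnto N = 0 :=
    Submodule.orthogonalProjectionOnto_orthogonalComplement_singleton_eq_zero N
  rw [this, smul_zero, zero_add, Submodule.orthogonalProjectionOnto_mem_subspace_eq_self]

lemma graphPt_inner_proj (hN : ‖N‖ = 1) (p : E) :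
    graphPt x N (inner ℝ N (p - x)) ((Hyp N).orthogonalProjectionOnto (p - x)) = p := by
  have h := Submodule.starProjection_add_starProjection_orthogonal (K := ℝ ∙ N) (p - x)
  rw [Submodule.starProjection_unit_singleton ℝ hN] at h
  rw [graphPt, add_assoc]
  exact (congrArg (x + ·) h).trans (by simp)

lemma graphPt_sub (s t : ℝ) (y z : Hyp N) :
    graphPt x N s y - graphPt x N t z = (s - t) • N + ((y - z : Hyp N) : E) := by
  simp only [graphPt, Submodule.coe_sub, sub_smul]; abel

lemma norm_graphPt_sub_le (hN : ‖N‖ = 1) (s t : ℝ) (y z : Hyp N) :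
    ‖graphPt x N s y - graphPt x N t z‖ ≤ |s - t| + ‖y - z‖ := by
  rw [graphPt_sub]
  refine (norm_add_le _ _).trans ?_
  rw [norm_smul, hN, mul_one, Real.norm_eq_abs]; rfl

lemma graphPt_mem_ball (hN : ‖N‖ = 1) {r t : ℝ} {y : Hyp N} (ht : |t| ≤ r) (hy : ‖y‖ < r) :
    graphPt x N t y ∈ ball x (2 * r) := by
  have h := norm_graphPt_sub_le (x := x) hN t 0 y 0
  rw [show graphPt x N 0 0 = x by simp [graphPt], sub_zero, sub_zero] at h
  rw [mem_ball, dist_eq_norm]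
  linarith

lemma graphPt_mem_cylinder (hN : ‖N‖ = 1) {r t : ℝ} {y : Hyp N} :
    graphPt x N t y ∈ cylinder x N r ↔ |t| < r ∧ ‖y‖ < r := by
  rw [cylinder, mem_ofPred_eq, inner_graphPt hN, proj_graphPt]

lemma cylinder_subset_ball (hN : ‖N‖ = 1) {r : ℝ} : cylinder x N r ⊆ ball x (2 * r) := by
  intro p hp
  rw [← graphPt_inner_proj (x := x) hN p]
  exact graphPt_mem_ball hN hp.1.le hp.2

lemma continuous_graphPt : Continuous fun p : ℝ × Hyp N => graphPt x N p.1 p.2 := by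
  unfold graphPt; fun_prop

lemma injective_graphPt (hN : ‖N‖ = 1) :
    Function.Injective fun p : ℝ × Hyp N => graphPt x N p.1 p.2 := by
  rintro ⟨s, y⟩ ⟨t, z⟩ h
  have h : graphPt x N s y = graphPt x N t z := h
  have h1 := inner_graphPt (x := x) hN s y
  have h2 := proj_graphPt (x := x) s y
  rw [h, inner_graphPt hN] at h1
  rw [h, proj_graphPt] at h2
  rw [h1, h2]

section Measure

variable [MeasurableSpace E] [BorelSpace E] [FiniteDimensional ℝ E]

/-- Orthogonal splitting preserves volume, which gives access to Fubini's theorem in the coordinates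
height and foot point. -/
lemma measurePreserving_graphPt (x : E) (hN : ‖N‖ = 1) :
    MeasurePreserving (fun p : ℝ × Hyp N => graphPt x N p.1 p.2) volume volume := by
  have h1 := (Submodule.measurePreserving_measurableEquivProd (ℝ ∙ N) x).symm
  rw [InnerProductSpace.euclideanHausdorffMeasure_eq_volume] at h1
  have h2 := ((LinearIsometryEquiv.toSpanUnitSingleton (𝕜 := ℝ) N hN).measurePreserving).prod
    (MeasurePreserving.id (volume : Measure (Hyp N)))
  have h3 := h1.comp h2
  convert! h3 using 1
  ext p
  simp [graphPt, add_comm, add_left_comm]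

lemma measurableEmbedding_graphPt (x : E) (hN : ‖N‖ = 1) :
    MeasurableEmbedding (fun p : ℝ × Hyp N => graphPt x N p.1 p.2) :=
  continuous_graphPt.measurableEmbedding (injective_graphPt hN)

omit [MeasurableSpace E] [BorelSpace E] [FiniteDimensional ℝ E] in
lemma finrank_Hyp (hE : finrank ℝ E = 3) (hN : ‖N‖ = 1) : finrank ℝ (Hyp N) = 2 := by
  have : Fact (finrank ℝ E = 2 + 1) := ⟨hE⟩
  exact Submodule.finrank_orthogonal_span_singleton (by rintro rfl; simp at hN)

end Measure

/-- Near `x`, the set `M` is the sublevel set `{g ≤ 0}` of a function whose gradient is close to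
the unit vector `N`, and the level set `{g = 0}` is the graph of `h` in direction `N`. -/
structure IsFlatChart (M : Set E) (g : E → ℝ) (x N : E) (r δ : ℝ) (h : Hyp N → ℝ) : Prop where
  norm_normal : ‖N‖ = 1
  radius_pos : 0 < r
  slope_nonneg : 0 ≤ δ
  slope_le : δ ≤ 1 / 2
  contDiffOn : ContDiffOn ℝ 1 g (ball x (2 * r))
  norm_fderiv_sub_le : ∀ p ∈ ball x (2 * r), ‖fderiv ℝ g p - innerSL ℝ N‖ ≤ δ
  mem_iff : ∀ p ∈ ball x (2 * r), p ∈ M ↔ g p ≤ 0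
  abs_height_lt : ∀ y : Hyp N, ‖y‖ < r → |h y| < r
  height_eq_zero : ∀ y : Hyp N, ‖y‖ < r → g (graphPt x N (h y) y) = 0

/-- The mean value inequality for `g` minus the linear form of `N`, on a convex ball. -/
lemma abs_sub_sub_inner_le {g : E → ℝ} {R δ : ℝ} (hg : ContDiffOn ℝ 1 g (ball x R))
    (hδ : ∀ p ∈ ball x R, ‖fderiv ℝ g p - innerSL ℝ N‖ ≤ δ) {p q : E} (hp : p ∈ ball x R)
    (hq : q ∈ ball x R) : |g q - g p - inner ℝ N (q - p)| ≤ δ * ‖q - p‖ :=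
  (convex_ball x R).norm_image_sub_le_of_norm_hasFDerivWithin_le' (φ := innerSL ℝ N)
    (fun _ hz => (((hg.differentiableOn one_ne_zero).differentiableAt
      (isOpen_ball.mem_nhds hz)).hasFDerivAt).hasFDerivWithinAt) hδ hp hq

/-- Moving up by `t - s` along `N` increases `g` by at least `(1 - δ) (t - s)`. -/
lemma strictMonoOn_graphPt {g : E → ℝ} {r δ : ℝ} (hN : ‖N‖ = 1) (hδ1 : δ ≤ 1 / 2)
    (hg : ContDiffOn ℝ 1 g (ball x (2 * r)))
    (hδ : ∀ p ∈ ball x (2 * r), ‖fderiv ℝ g p - innerSL ℝ N‖ ≤ δ) {y : Hyp N} (hy : ‖y‖ < r) :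
    StrictMonoOn (fun t => g (graphPt x N t y)) (Icc (-r) r) := by
  intro s hs t ht hst
  have h := abs_sub_sub_inner_le hg hδ (graphPt_mem_ball (x := x) hN (abs_le.2 hs) hy)
    (graphPt_mem_ball (x := x) hN (abs_le.2 ht) hy)
  have e : graphPt x N t y - graphPt x N s y = (t - s) • N := by rw [graphPt_sub]; simp
  rw [e, norm_smul, hN, real_inner_smul_right, real_inner_self_eq_norm_sq, hN, Real.norm_eq_abs,
    abs_of_pos (sub_pos.2 hst)] at h
  have := (abs_le.1 h).1
  simp only
  nlinarith

/-- A smooth boundary point has a flat chart. -/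
lemma exists_isFlatChart {M : Set E} {g : E → ℝ} {δ : ℝ} (hN : ‖N‖ = 1) (hδ0 : 0 < δ)
    (hδ1 : δ ≤ 1 / 2) (hg : ContDiffAt ℝ 1 g x) (hx : g x = 0) (hd : fderiv ℝ g x = innerSL ℝ N)
    (hM : ∀ᶠ y in 𝓝 x, y ∈ M ↔ g y ≤ 0) :
    ∃ r h, IsFlatChart M g x N r δ h := by
  have h1 : ∀ᶠ p in 𝓝 x, ContDiffAt ℝ 1 g p := hg.eventually (by simp)
  have h2 : ∀ᶠ p in 𝓝 x, ‖fderiv ℝ g p - innerSL ℝ N‖ < δ := by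
    have hc : ContinuousAt (fun p => ‖fderiv ℝ g p - innerSL ℝ N‖) x :=
      ((hg.fderiv_right (m := 0) (by simp)).continuousAt.sub continuousAt_const).norm
    refine hc.eventually_lt continuousAt_const ?_
    simpa [hd] using hδ0
  obtain ⟨R, hR, hball⟩ := Metric.eventually_nhds_iff_ball.1 ((h1.and h2).and hM)
  set r := R / 2 with hr
  have hr0 : 0 < r := by positivity
  have h2r : 2 * r = R := by rw [hr]; ring
  have hgc : ContDiffOn ℝ 1 g (ball x (2 * r)) := fun p hp =>
    (hball p (h2r ▸ hp)).1.1.contDiffWithinAt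
  have hgd : ∀ p ∈ ball x (2 * r), ‖fderiv ℝ g p - innerSL ℝ N‖ ≤ δ := fun p hp =>
    (hball p (h2r ▸ hp)).1.2.le
  have hex : ∀ y : Hyp N, ∃ t, ‖y‖ < r → |t| < r ∧ g (graphPt x N t y) = 0 := by
    intro y
    by_cases hy : ‖y‖ < r
    swap
    · exact ⟨0, fun h => absurd h hy⟩
    -- At height `t` over `y`, `g` differs from `t` by at most half the distance to `x`, which is
    -- below `2 r`. So `g` is negative at height `-r` and positive at `r`, and has a zero between.
    have hend : ∀ t : ℝ, |t| = r → |g (graphPt x N t y) - t| < r := by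
      intro t ht
      have hb := graphPt_mem_ball (x := x) hN ht.le hy
      have := abs_sub_sub_inner_le hgc hgd (mem_ball_self (by positivity)) hb
      rw [hx, sub_zero, inner_graphPt hN] at this
      rw [mem_ball, dist_eq_norm] at hb
      calc _ ≤ _ := this
        _ ≤ 1 / 2 * ‖graphPt x N t y - x‖ := by gcongr
        _ < r := by linarith
    have hbot := (abs_lt.1 (hend (-r) (by rw [abs_neg, abs_of_pos hr0]))).2
    have htop := (abs_lt.1 (hend r (abs_of_pos hr0))).1
    have hcont : ContinuousOn (fun t => g (graphPt x N t y)) (Icc (-r) r) :=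
      hgc.continuousOn.comp (continuous_graphPt.comp (by fun_prop :
        Continuous fun t : ℝ => (t, y))).continuousOn
        fun t ht => graphPt_mem_ball hN (abs_le.2 ht) hy
    obtain ⟨t, ht, ht0⟩ := intermediate_value_Ioo (by linarith) hcont
      (show (0 : ℝ) ∈ Ioo _ _ from ⟨by linarith, by linarith⟩)
    exact ⟨t, fun _ => ⟨abs_lt.2 ht, ht0⟩⟩
  choose h hh using hex
  exact ⟨r, h, hN, hr0, hδ0.le, hδ1, hgc, hgd, fun p hp => (hball p (h2r ▸ hp)).2,
    fun y hy => (hh y hy).1, fun y hy => (hh y hy).2⟩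

namespace IsFlatChart

variable {M : Set E} {g : E → ℝ} {r δ : ℝ} {h : Hyp N → ℝ}

lemma neg_iff (c : IsFlatChart M g x N r δ h) {y : Hyp N} (hy : ‖y‖ < r) {t : ℝ} (ht : |t| ≤ r) :
    g (graphPt x N t y) < 0 ↔ t < h y := by
  have := (strictMonoOn_graphPt c.norm_normal c.slope_le c.contDiffOn c.norm_fderiv_sub_le hy).lt_iff_lt
    (abs_le.1 ht) (abs_le.1 (c.abs_height_lt y hy).le)
  rwa [c.height_eq_zero y hy] at this

lemma eq_zero_iff (c : IsFlatChart M g x N r δ h) {y : Hyp N} (hy : ‖y‖ < r) {t : ℝ}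
    (ht : |t| ≤ r) : g (graphPt x N t y) = 0 ↔ t = h y := by
  have := (strictMonoOn_graphPt c.norm_normal c.slope_le c.contDiffOn c.norm_fderiv_sub_le hy).eq_iff_eq
    (abs_le.1 ht) (abs_le.1 (c.abs_height_lt y hy).le)
  rwa [c.height_eq_zero y hy] at this

/-- At an interior point with `g = 0`, `g` would have a local maximum and zero derivative, but its
derivative is within 1/2 of a unit form. -/
lemma mem_interior_iff (c : IsFlatChart M g x N r δ h) {p : E} (hp : p ∈ ball x (2 * r)) :
    p ∈ interior M ↔ g p < 0 := by
  have hb : ball x (2 * r) ∈ 𝓝 p := isOpen_ball.mem_nhds hp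
  constructor
  · intro hpi
    refine lt_of_le_of_ne ((c.mem_iff p hp).1 (interior_subset hpi)) fun h0 => ?_
    have hmax : IsLocalMax g p := by
      filter_upwards [hb, isOpen_interior.mem_nhds hpi] with q hq hqi
      rw [h0]
      exact (c.mem_iff q hq).1 (interior_subset hqi)
    have := c.norm_fderiv_sub_le p hp
    rw [hmax.fderiv_eq_zero, zero_sub, norm_neg, innerSL_apply_norm, c.norm_normal] at this
    linarith [c.slope_le]
  · intro hg
    rw [mem_interior_iff_mem_nhds]
    filter_upwards [hb, (c.contDiffOn.continuousOn.continuousAt hb).eventually_lt_const hg]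
      with q hq hq0
    exact (c.mem_iff q hq).2 hq0.le

lemma mem_frontier_iff (c : IsFlatChart M g x N r δ h) (hM : IsClosed M) {p : E}
    (hp : p ∈ ball x (2 * r)) : p ∈ frontier M ↔ g p = 0 := by
  rw [hM.frontier_eq, Set.mem_sdiff, c.mem_interior_iff hp, c.mem_iff p hp, not_lt]
  exact ⟨fun H => le_antisymm H.1 H.2, fun H => ⟨H.le, H.ge⟩⟩

/-- The parametrization of the boundary over the hyperplane. -/
def graph (_c : IsFlatChart M g x N r δ h) (y : Hyp N) : E := graphPt x N (h y) y

lemma graph_mem_cylinder (c : IsFlatChart M g x N r δ h) {y : Hyp N} (hy : ‖y‖ < r) :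
    c.graph y ∈ cylinder x N r :=
  (graphPt_mem_cylinder c.norm_normal).2 ⟨c.abs_height_lt y hy, hy⟩

lemma graph_mem_frontier (c : IsFlatChart M g x N r δ h) (hM : IsClosed M) {y : Hyp N}
    (hy : ‖y‖ < r) : c.graph y ∈ frontier M :=
  (c.mem_frontier_iff hM (cylinder_subset_ball c.norm_normal (c.graph_mem_cylinder hy))).2
    (c.height_eq_zero y hy)

lemma graph_proj (c : IsFlatChart M g x N r δ h) (hM : IsClosed M) {p : E}
    (hp : p ∈ frontier M ∩ cylinder x N r) :
    c.graph ((Hyp N).orthogonalProjectionOnto (p - x)) = p := by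
  have hb := cylinder_subset_ball c.norm_normal hp.2
  have h0 := (c.mem_frontier_iff hM hb).1 hp.1
  have e := graphPt_inner_proj (x := x) c.norm_normal p
  rw [← e, c.eq_zero_iff hp.2.2 hp.2.1.le] at h0
  rw [graph, ← h0, e]

lemma proj_graph (c : IsFlatChart M g x N r δ h) (y : Hyp N) :
    (Hyp N).orthogonalProjectionOnto (c.graph y - x) = y := proj_graphPt _ _

/-- Two graph points `p`, `q` satisfy `g = 0`, so their heights differ by at most `δ ‖p - q‖`. Then
`‖p - q‖ ≤ δ ‖p - q‖ + ‖y - z‖`, and the first term is absorbed on the left. -/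
lemma lipschitzOnWith_graph (c : IsFlatChart M g x N r δ h) :
    LipschitzOnWith (Real.toNNReal (1 - δ)⁻¹) c.graph (ball 0 r) := by
  have hδ : 0 < 1 - δ := by linarith [c.slope_le]
  refine LipschitzOnWith.of_dist_le_mul fun y hy z hz => ?_
  rw [mem_ball_zero_iff] at hy hz
  rw [Real.coe_toNNReal _ (inv_pos.2 hδ).le, dist_eq_norm, dist_eq_norm, inv_mul_eq_div,
    le_div_iff₀ hδ]
  have h1 := abs_sub_sub_inner_le c.contDiffOn c.norm_fderiv_sub_le
    (cylinder_subset_ball c.norm_normal (c.graph_mem_cylinder hz))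
    (cylinder_subset_ball c.norm_normal (c.graph_mem_cylinder hy))
  have h2 : g (c.graph y) = 0 := c.height_eq_zero y hy
  have h3 : g (c.graph z) = 0 := c.height_eq_zero z hz
  have h4 : inner ℝ N (c.graph y - c.graph z) = h y - h z := by
    rw [← sub_sub_sub_cancel_right _ _ x, inner_sub_right]
    exact congrArg₂ _ (inner_graphPt c.norm_normal _ _) (inner_graphPt c.norm_normal _ _)
  have h5 : ‖c.graph y - c.graph z‖ ≤ |h y - h z| + ‖y - z‖ :=
    norm_graphPt_sub_le c.norm_normal _ _ _ _
  rw [h2, h3, h4, sub_zero, zero_sub, abs_neg] at h1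
  linarith

end IsFlatChart

end FlatChart

/-! ### Normal derivatives and projected area in a chart -/

namespace IsFlatChart

variable {E : Type*} [NormedAddCommGroup E] [InnerProductSpace ℝ E] [FiniteDimensional ℝ E]
  [MeasurableSpace E] [BorelSpace E]
  {W : Type*} [NormedAddCommGroup W] [NormedSpace ℝ W] [CompleteSpace W]
  {x N : E} {M : Set E} {g : E → ℝ} {r δ : ℝ} {h : Hyp N → ℝ}

/-- Fubini's theorem and the fundamental theorem of calculus along the lines in direction `N`. -/
lemma integral_fderiv_normal (c : IsFlatChart M g x N r δ h) (hM : IsCompact M) {F : E → W}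
    (hF : IsC1UpTo M F) {K : Set E} (hK : IsClosed K) (hKU : K ⊆ cylinder x N r)
    (hF0 : ∀ p ∈ M, p ∉ K → F p = 0) :
    ∫ p in interior M, fderiv ℝ F p N = ∫ y in ball 0 r, F (c.graph y) := by
  have hN := c.norm_normal
  have hr := c.radius_pos
  set A : Set E := interior M ∩ cylinder x N r with hA
  have hAo : IsOpen A := isOpen_interior.inter (isOpen_cylinder x N r)
  have hd0 : ∀ p ∈ interior M, p ∉ K → fderiv ℝ F p = 0 := by
    intro p hp hpK
    have : F =ᶠ[𝓝 p] fun _ => 0 := by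
      filter_upwards [isOpen_interior.mem_nhds hp, hK.isOpen_compl.mem_nhds hpK] with q hq hqK
      exact hF0 q (interior_subset hq) hqK
    rw [this.fderiv_eq, fderiv_fun_const]; rfl
  have hi : IntegrableOn (fun p => fderiv ℝ F p N) (interior M) volume :=
    hF.integrableOn_fderiv hM N
  have hmp := measurePreserving_graphPt (N := N) x hN
  have hme := measurableEmbedding_graphPt (N := N) x hN
  set G : E → W := A.indicator fun p => fderiv ℝ F p N with hG
  have hGi : Integrable G volume :=
    (integrable_indicator_iff hAo.measurableSet).2 (hi.mono_set inter_subset_left)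
  have hGi' : Integrable (fun z : ℝ × Hyp N => G (graphPt x N z.1 z.2))
      ((volume : Measure ℝ).prod (volume : Measure (Hyp N))) := hmp.integrable_comp_of_integrable hGi
  -- Inside the cylinder, the vertical line over `y` meets the interior of `M` exactly in the
  -- heights between `-r` and `h y`.
  have hline : ∀ y : Hyp N, ∫ t, G (graphPt x N t y) =
      (ball (0 : Hyp N) r).indicator (fun y => F (c.graph y)) y := by
    intro y
    by_cases hy : ‖y‖ < r
    swap
    · rw [indicator_of_notMem (by simpa using hy)]
      refine integral_eq_zero_of_ae (Eventually.of_forall fun t => ?_)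
      exact indicator_of_notMem (fun H => hy ((graphPt_mem_cylinder hN).1 H.2).2) _
    · rw [indicator_of_mem (by simpa using hy)]
      have hh := abs_lt.1 (c.abs_height_lt y hy)
      have hmemA : ∀ t : ℝ, graphPt x N t y ∈ A ↔ t ∈ Ioo (-r) (h y) := by
        intro t
        constructor
        · rintro ⟨h1, h2⟩
          have ht := ((graphPt_mem_cylinder hN).1 h2).1
          exact ⟨(abs_lt.1 ht).1, (c.neg_iff hy ht.le).1
            ((c.mem_interior_iff (graphPt_mem_ball hN ht.le hy)).1 h1)⟩
        · intro ht
          have ht' : |t| < r := abs_lt.2 ⟨ht.1, ht.2.trans hh.2⟩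
          exact ⟨(c.mem_interior_iff (graphPt_mem_ball hN ht'.le hy)).2
            ((c.neg_iff hy ht'.le).2 ht.2), (graphPt_mem_cylinder hN).2 ⟨ht', hy⟩⟩
      have hcomp : (fun t => G (graphPt x N t y)) = (Ioo (-r) (h y)).indicator
          fun t => fderiv ℝ F (graphPt x N t y) N := by
        ext t
        simp only [hG, indicator, hmemA]
      have hcl : Continuous fun t : ℝ => graphPt x N t y :=
        continuous_graphPt.comp (by fun_prop : Continuous fun t : ℝ => (t, y))
      have hmemM : ∀ t ∈ Icc (-r) (h y), graphPt x N t y ∈ M := by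
        intro t ht
        have ht' : |t| ≤ r := abs_le.2 ⟨ht.1, ht.2.trans hh.2.le⟩
        rw [c.mem_iff _ (graphPt_mem_ball hN ht' hy)]
        rcases ht.2.lt_or_eq with hlt | heq
        · exact ((c.neg_iff hy ht').2 hlt).le
        · exact ((c.eq_zero_iff hy ht').2 heq).le
      have hderiv : ∀ t ∈ Ioo (-r) (h y),
          HasDerivAt (fun t => F (graphPt x N t y)) (fderiv ℝ F (graphPt x N t y) N) t := by
        intro t ht
        have h1 : HasDerivAt (fun t : ℝ => graphPt x N t y) N t := by
          unfold graphPt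
          simpa using (((hasDerivAt_id t).smul_const N).const_add x).add_const (y : E)
        exact (hF.differentiableAt _ ((hmemA t).2 ht).1).hasFDerivAt.comp_hasDerivAt t h1
      have hint : IntervalIntegrable (fun t => fderiv ℝ F (graphPt x N t y) N) volume (-r) (h y) := by
        rw [intervalIntegrable_iff_integrableOn_Ioo_of_le hh.1.le]
        obtain ⟨C, hC⟩ := hF.bounded_fderiv
        refine IntegrableOn.of_bound measure_Ioo_lt_top ?_ C ?_
        · refine ContinuousOn.aestronglyMeasurable ?_ measurableSet_Ioo
          exact (hF.continuousOn_fderiv.comp hcl.continuousOn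
            fun t ht => ((hmemA t).2 ht).1).clm_apply continuousOn_const
        · refine (ae_restrict_iff' measurableSet_Ioo).2 (Eventually.of_forall fun t ht => ?_)
          refine ((fderiv ℝ F _).le_opNorm N).trans ?_
          rw [hN, mul_one]
          exact hC _ ((hmemA t).2 ht).1
      -- The lower endpoint is in `M` but outside the open cylinder, hence outside `K`: only the
      -- boundary value on the graph survives.
      have hzero : F (graphPt x N (-r) y) = 0 := by
        refine hF0 _ (hmemM _ ⟨le_rfl, hh.1.le⟩) fun H => ?_
        have := ((graphPt_mem_cylinder hN).1 (hKU H)).1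
        rw [abs_neg, abs_of_pos hr] at this
        exact lt_irrefl _ this
      have hftc := intervalIntegral.integral_eq_sub_of_hasDerivAt_of_le hh.1.le
        (hF.continuousOn.comp hcl.continuousOn hmemM) hderiv hint
      rw [hcomp, integral_indicator measurableSet_Ioo, ← integral_Ioc_eq_integral_Ioo,
        ← intervalIntegral.integral_of_le hh.1.le, hftc]
      simp only [Function.comp_apply, hzero, sub_zero]
      rfl
  calc ∫ p in interior M, fderiv ℝ F p N = ∫ p in A, fderiv ℝ F p N := by
        apply setIntegral_eq_of_subset_of_forall_sdiff_eq_zero isOpen_interior.measurableSet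
          inter_subset_left
        intro p hp
        rw [hd0 p hp.1 fun H => hp.2 ⟨hp.1, hKU H⟩]; rfl
    _ = ∫ p, G p := (integral_indicator hAo.measurableSet).symm
    _ = ∫ z : ℝ × Hyp N, G (graphPt x N z.1 z.2) := (hmp.integral_comp hme G).symm
    _ = ∫ y : Hyp N, ∫ t, G (graphPt x N t y) := integral_prod_symm _ hGi'
    _ = ∫ y in ball 0 r, F (c.graph y) := by
        simp_rw [hline]
        exact integral_indicator isOpen_ball.measurableSet

/-- The measure on the boundary that projects to the area in the hyperplane. -/
def projMeasure (c : IsFlatChart M g x N r δ h) : Measure E :=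
  ((volume : Measure (Hyp N)).restrict (ball 0 r)).map c.graph

lemma aemeasurable_graph (c : IsFlatChart M g x N r δ h) :
    AEMeasurable c.graph ((volume : Measure (Hyp N)).restrict (ball 0 r)) :=
  c.lipschitzOnWith_graph.continuousOn.aemeasurable isOpen_ball.measurableSet

instance (c : IsFlatChart M g x N r δ h) : IsFiniteMeasure c.projMeasure := by
  have : IsFiniteMeasure ((volume : Measure (Hyp N)).restrict (ball 0 r)) :=
    ⟨by rw [Measure.restrict_apply_univ]; exact measure_ball_lt_top⟩
  unfold projMeasure
  infer_instance

lemma projMeasure_apply (c : IsFlatChart M g x N r δ h) {A : Set E} (hA : MeasurableSet A) :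
    c.projMeasure A = volume (c.graph ⁻¹' A ∩ ball 0 r) := by
  rw [projMeasure, Measure.map_apply_of_aemeasurable c.aemeasurable_graph hA,
    Measure.restrict_apply' isOpen_ball.measurableSet]

omit [FiniteDimensional ℝ E] [MeasurableSpace E] [BorelSpace E] in
lemma image_graph (c : IsFlatChart M g x N r δ h) (hM : IsClosed M) (A : Set E) :
    c.graph '' (c.graph ⁻¹' A ∩ ball 0 r) = A ∩ (frontier M ∩ cylinder x N r) := by
  ext p
  constructor
  · rintro ⟨y, ⟨hyA, hy⟩, rfl⟩
    rw [mem_ball_zero_iff] at hy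
    exact ⟨hyA, c.graph_mem_frontier hM hy, c.graph_mem_cylinder hy⟩
  · rintro ⟨hpA, hp⟩
    have := c.graph_proj hM hp
    exact ⟨_, ⟨by rwa [mem_preimage, this], mem_ball_zero_iff.2 hp.2.2⟩, this⟩

omit [InnerProductSpace ℝ E] [FiniteDimensional ℝ E] in
lemma _root_.LipschitzOnWith.euclideanHausdorffMeasure_image_le {X Y : Type*} [EMetricSpace X]
    [MeasurableSpace X] [BorelSpace X] [EMetricSpace Y] [MeasurableSpace Y] [BorelSpace Y]
    {K : NNReal} {f : X → Y} {s : Set X} (hf : LipschitzOnWith K f s) (d : ℕ) :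
    μHE[d] (f '' s) ≤ (K : ENNReal) ^ d * μHE[d] s := by
  simp only [Measure.euclideanHausdorffMeasure_def, Measure.smul_apply]
  have := hf.hausdorffMeasure_image_le (d := d) (Nat.cast_nonneg d)
  rw [ENNReal.rpow_natCast] at this
  rw [ENNReal.smul_def, ENNReal.smul_def, smul_eq_mul, smul_eq_mul, mul_left_comm]
  gcongr

lemma euclideanHausdorffMeasure_Hyp (hE : finrank ℝ E = 3) (hN : ‖N‖ = 1) :
    (μHE[2] : Measure (Hyp N)) = volume := by
  rw [← finrank_Hyp hE hN]
  exact InnerProductSpace.euclideanHausdorffMeasure_eq_volume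

/-- Orthogonal projection is 1-Lipschitz and inverts the graph map, so projecting does not increase
area. -/
lemma projMeasure_le (c : IsFlatChart M g x N r δ h) (hE : finrank ℝ E = 3) (hM : IsClosed M) :
    c.projMeasure ≤ (μHE[2]).restrict (frontier M ∩ cylinder x N r) := by
  refine Measure.le_iff.2 fun A hA => ?_
  rw [c.projMeasure_apply hA, Measure.restrict_apply hA, ← c.image_graph hM A,
    ← euclideanHausdorffMeasure_Hyp hE c.norm_normal]
  set D := c.graph ⁻¹' A ∩ ball 0 r
  have hlip : LipschitzWith 1 fun p => (Hyp N).orthogonalProjectionOnto (p - x) := by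
    refine LipschitzWith.of_dist_le_mul fun p q => ?_
    rw [dist_eq_norm, ← map_sub, sub_sub_sub_cancel_right, NNReal.coe_one, one_mul, dist_eq_norm]
    exact (Hyp N).norm_orthogonalProjectionOnto_apply_le _
  have h1 := (hlip.lipschitzOnWith (s := c.graph '' D)).euclideanHausdorffMeasure_image_le 2
  rw [image_image] at h1
  simpa [c.proj_graph] using h1

/-- The graph map has Lipschitz constant `(1 - δ)⁻¹`, so it enlarges area at most by `(1 - δ)⁻²`,
which is below `1 + 8 δ` when `δ ≤ 1/2`. -/
lemma restrict_le_smul_projMeasure (c : IsFlatChart M g x N r δ h) (hE : finrank ℝ E = 3)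
    (hM : IsClosed M) :
    (μHE[2]).restrict (frontier M ∩ cylinder x N r) ≤ ENNReal.ofReal (1 + 8 * δ) • c.projMeasure := by
  refine Measure.le_iff.2 fun A hA => ?_
  rw [Measure.smul_apply, c.projMeasure_apply hA, Measure.restrict_apply hA, ← c.image_graph hM A,
    ← euclideanHausdorffMeasure_Hyp hE c.norm_normal]
  refine ((c.lipschitzOnWith_graph.mono inter_subset_right).euclideanHausdorffMeasure_image_le
    2).trans ?_
  rw [smul_eq_mul]
  gcongr
  have h0 := c.slope_nonneg
  have h1 := c.slope_le
  have h2 : 0 < 1 - δ := by linarith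
  change ENNReal.ofReal _ ^ 2 ≤ _
  rw [← ENNReal.ofReal_pow (inv_pos.2 h2).le]
  refine ENNReal.ofReal_le_ofReal ?_
  rw [inv_pow, inv_le_iff_one_le_mul₀ (by positivity)]
  nlinarith [mul_nonneg h0 (sub_nonneg.2 h1), mul_nonneg h0 h0]

end IsFlatChart

/-! ### The approximate divergence theorem in a chart -/

namespace IsFlatChart

variable {E : Type*} [NormedAddCommGroup E] [InnerProductSpace ℝ E] [FiniteDimensional ℝ E]
  [MeasurableSpace E] [BorelSpace E]
  {W : Type*} [NormedAddCommGroup W] [NormedSpace ℝ W] [CompleteSpace W]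
  {x N : E} {M : Set E} {g : E → ℝ} {r δ : ℝ} {h : Hyp N → ℝ}

/-- A smooth approximation of the indicator function of `{g < 0}`. -/
def ramp (g : E → ℝ) (k : ℕ) (p : E) : ℝ := Real.smoothTransition (-(k * g p) - 1)

omit [NormedAddCommGroup E] [InnerProductSpace ℝ E] [FiniteDimensional ℝ E] [MeasurableSpace E]
  [BorelSpace E] in
lemma tendsto_ramp {p : E} (hp : g p < 0) : Tendsto (fun k => ramp g k p) atTop (𝓝 1) := by
  obtain ⟨n, hn⟩ := exists_nat_ge (2 / -g p)
  rw [div_le_iff₀ (neg_pos.2 hp)] at hn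
  refine tendsto_const_nhds.congr' ?_
  filter_upwards [eventually_ge_atTop n] with k hk
  refine (Real.smoothTransition.one_of_one_le ?_).symm
  have : (n : ℝ) ≤ k := by exact_mod_cast hk
  nlinarith

omit [FiniteDimensional ℝ E] [MeasurableSpace E] [BorelSpace E] in
-- The left side is at most `δ ‖w‖`, while the derivative along `N` is at least `1 - δ ≥ 1/2`.
lemma tangential_slope_le (c : IsFlatChart M g x N r δ h) {p w : E} (hp : p ∈ ball x (2 * r))
    (hw : inner ℝ N w = 0) : |fderiv ℝ g p w| ≤ 2 * δ * ‖w‖ * fderiv ℝ g p N := by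
  have h1 := c.norm_fderiv_sub_le p hp
  have h2 : |fderiv ℝ g p w - inner ℝ N w| ≤ δ * ‖w‖ :=
    ((fderiv ℝ g p - innerSL ℝ N).le_opNorm w).trans (by gcongr)
  have h3 : |fderiv ℝ g p N - inner ℝ N N| ≤ δ * ‖N‖ :=
    ((fderiv ℝ g p - innerSL ℝ N).le_opNorm N).trans (by gcongr)
  rw [hw, sub_zero] at h2
  rw [real_inner_self_eq_norm_sq, c.norm_normal] at h3
  have h4 := (abs_le.1 h3).1
  have h5 : 0 ≤ δ * ‖w‖ := mul_nonneg c.slope_nonneg (norm_nonneg _)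
  nlinarith [c.slope_le]

omit [CompleteSpace W] in
-- With `u k = ramp g k * φ` supported in the interior, the derivatives of `u k • f` and `u k`
-- integrate to zero. What remains of `∫ ramp • ∂_w (φ f)` is the term where the ramp is
-- differentiated, with `∂_w g` as a factor. It is dominated by `2 δ ‖w‖ A` times the same term for
-- direction `N` and `f = 1`, which equals `∫ ramp * ∂_N φ`. Then `k → ∞`.
lemma norm_integral_fderiv_tangential_le (c : IsFlatChart M g x N r δ h) (hM : IsCompact M)
    {φ : E → ℝ} (hφ : ContDiff ℝ 1 φ) (hφ0 : ∀ p, 0 ≤ φ p) (hsupp : tsupport φ ⊆ cylinder x N r)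
    {f : E → W} (hf : IsC1UpTo M f) {A : ℝ} (hA : ∀ p ∈ M, ‖f p‖ ≤ A) {w : E}
    (hw : inner ℝ N w = 0) :
    ‖∫ p in interior M, fderiv ℝ (fun q => φ q • f q) p w‖ ≤
      2 * δ * ‖w‖ * A * ∫ p in interior M, fderiv ℝ φ p N := by
  have hN := c.norm_normal
  set U := interior M ∩ cylinder x N r with hU
  have hUo : IsOpen U := isOpen_interior.inter (isOpen_cylinder x N r)
  have hUM : U ⊆ interior M := inter_subset_left
  have hball : ∀ p ∈ cylinder x N r, p ∈ ball x (2 * r) := fun p hp => cylinder_subset_ball hN hp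
  have hgat : ∀ p ∈ cylinder x N r, ContDiffAt ℝ 1 g p := fun p hp =>
    c.contDiffOn.contDiffAt (isOpen_ball.mem_nhds (hball p hp))
  have hgdiff : ∀ p ∈ cylinder x N r, DifferentiableAt ℝ g p := fun p hp =>
    (hgat p hp).differentiableAt one_ne_zero
  have hred {G : E → W} (hG : ∀ p ∉ tsupport φ, G p = 0) :
      ∫ p in interior M, G p = ∫ p in U, G p := by
    apply setIntegral_eq_of_subset_of_forall_sdiff_eq_zero isOpen_interior.measurableSet hUM
    intro p hp
    exact hG p fun H => hp.2 ⟨hp.1, hsupp H⟩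
  have hredR {G : E → ℝ} (hG : ∀ p ∉ tsupport φ, G p = 0) :
      ∫ p in interior M, G p = ∫ p in U, G p := by
    apply setIntegral_eq_of_subset_of_forall_sdiff_eq_zero isOpen_interior.measurableSet hUM
    intro p hp
    exact hG p fun H => hp.2 ⟨hp.1, hsupp H⟩
  have hzero {u : E → ℝ} (hu : ∀ p, φ p = 0 → u p = 0) {p : E} (hp : p ∉ tsupport φ) (v : E) :
      fderiv ℝ (fun q => u q • f q) p v = 0 := by
    have : (fun q => u q • f q) =ᶠ[𝓝 p] fun _ => 0 := by
      filter_upwards [notMem_tsupport_iff_eventuallyEq.1 hp] with q hq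
      rw [hu q hq, zero_smul]
    rw [this.fderiv_eq, fderiv_fun_const]; rfl
  have hzeroR {u : E → ℝ} (hu : ∀ p, φ p = 0 → u p = 0) {p : E} (hp : p ∉ tsupport φ) (v : E) :
      fderiv ℝ u p v = 0 := by
    have : u =ᶠ[𝓝 p] fun _ => 0 := by
      filter_upwards [notMem_tsupport_iff_eventuallyEq.1 hp] with q hq
      exact hu q hq
    rw [this.fderiv_eq, fderiv_fun_const]; rfl
  let u : ℕ → E → ℝ := fun k p => ramp g k p * φ p
  have hu0 : ∀ k p, φ p = 0 → u k p = 0 := fun k p hp => by simp [u, hp]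
  have hrampd : ∀ k, ∀ p ∈ cylinder x N r, ContDiffAt ℝ 1 (ramp g k) p := fun k p hp =>
    Real.smoothTransition.contDiffAt.comp p
      ((contDiffAt_const.mul (hgat p hp)).neg.sub contDiffAt_const)
  have hu : ∀ k, ContDiff ℝ 1 (u k) := by
    intro k
    rw [contDiff_iff_contDiffAt]
    intro p
    by_cases hp : p ∈ tsupport φ
    · exact (hrampd k p (hsupp hp)).mul hφ.contDiffAt
    · refine (contDiffAt_const (c := (0 : ℝ))).congr_of_eventuallyEq ?_
      filter_upwards [notMem_tsupport_iff_eventuallyEq.1 hp] with q hq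
      exact hu0 k q hq
  have husupp : ∀ k, tsupport (u k) ⊆ interior M := by
    intro k p hp
    by_contra hpM
    refine (notMem_tsupport_iff_eventuallyEq.2 ?_ : p ∉ tsupport (u k)) hp
    by_cases hpφ : p ∈ tsupport φ
    · have hpc := hsupp hpφ
      have hgp : 0 ≤ g p := not_lt.1 fun H => hpM ((c.mem_interior_iff (hball p hpc)).2 H)
      have hc : ContinuousAt (fun q => (k : ℝ) * g q) p :=
        continuousAt_const.mul (hgat p hpc).continuousAt
      -- The shift by one in the ramp makes it vanish wherever `k g ≥ -1`, thus on a whole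
      -- neighbourhood of a point with `g ≥ 0`.
      filter_upwards [hc.eventually_const_lt (show (-1 : ℝ) < k * g p by
        have : (0 : ℝ) ≤ k * g p := by positivity
        linarith)] with q hq
      have : ramp g k q = 0 := Real.smoothTransition.zero_of_nonpos (by linarith)
      simp [u, this]
    · filter_upwards [notMem_tsupport_iff_eventuallyEq.1 hpφ] with q hq
      exact hu0 k q hq
  -- Minus the derivative of the ramp with respect to the value of `g`; its sign makes the
  -- comparison of directions possible.
  let s : ℕ → E → ℝ := fun k p => deriv Real.smoothTransition (-(k * g p) - 1) * k
  have hs0 : ∀ k p, 0 ≤ s k p := fun k p =>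
    mul_nonneg (Real.smoothTransition.monotone.deriv_nonneg) (Nat.cast_nonneg k)
  have hdu : ∀ k, ∀ p ∈ cylinder x N r, ∀ v, fderiv ℝ (u k) p v =
      ramp g k p * fderiv ℝ φ p v - φ p * (s k p * fderiv ℝ g p v) := by
    intro k p hp v
    have h1 : HasFDerivAt (fun q => -((k : ℝ) * g q) - 1) (-((k : ℝ) • fderiv ℝ g p)) p :=
      (((hgdiff p hp).hasFDerivAt.const_mul (k : ℝ)).neg).sub_const 1
    have h2 : HasFDerivAt (ramp g k)
        (deriv Real.smoothTransition (-(k * g p) - 1) • -((k : ℝ) • fderiv ℝ g p)) p :=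
      ((Real.smoothTransition.contDiff (n := 1)).differentiable one_ne_zero
        _).hasDerivAt.comp_hasFDerivAt p h1
    have h3 := h2.mul (hφ.differentiable one_ne_zero p).hasFDerivAt
    rw [show fderiv ℝ (u k) p = _ from h3.fderiv]
    simp [s]
    ring
  have hφ1 : IsC1UpTo M φ := isC1UpTo_of_contDiffOn hM hφ.contDiffOn
  have hrc : ∀ k, ContinuousOn (ramp g k) U := fun k p hp =>
    (hrampd k p hp.2).continuousAt.continuousWithinAt
  have hrb : ∀ k p, ‖ramp g k p‖ ≤ 1 := fun k p => by
    rw [ramp, Real.norm_of_nonneg (Real.smoothTransition.nonneg _)]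
    exact Real.smoothTransition.le_one _
  have hF := hf.smul hM hφ
  have iF : IntegrableOn (fun p => fderiv ℝ (fun q => φ q • f q) p w) U volume :=
    (hF.integrableOn_fderiv hM w).mono_set hUM
  have iφ : IntegrableOn (fun p => fderiv ℝ φ p N) U volume :=
    (hφ1.integrableOn_fderiv hM N).mono_set hUM
  have irF : ∀ k, IntegrableOn (fun p => ramp g k p • fderiv ℝ (fun q => φ q • f q) p w) U volume :=
    fun k => iF.bdd_smul 1 ((hrc k).aestronglyMeasurable hUo.measurableSet)
      (Eventually.of_forall (hrb k))
  have irφ : ∀ k, IntegrableOn (fun p => ramp g k p * fderiv ℝ φ p N) U volume :=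
    fun k => iφ.bdd_mul ((hrc k).aestronglyMeasurable hUo.measurableSet)
      (Eventually.of_forall (hrb k))
  have hu1 : ∀ k, IsC1UpTo M (u k) := fun k => isC1UpTo_of_contDiffOn hM (hu k).contDiffOn
  have iu : ∀ k, IntegrableOn (fun p => fderiv ℝ (u k) p N) U volume := fun k =>
    ((hu1 k).integrableOn_fderiv hM N).mono_set hUM
  have iuf : ∀ k, IntegrableOn (fun p => fderiv ℝ (fun q => u k q • f q) p w) U volume := fun k =>
    ((hf.smul hM (hu k)).integrableOn_fderiv hM w).mono_set hUM
  have z1 : ∀ k, ∫ p in U, fderiv ℝ (fun q => u k q • f q) p w = 0 := fun k => by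
    rw [← hred fun p hp => hzero (hu0 k) hp w]
    exact hf.integral_fderiv_smul_eq_zero hM (hu k) (husupp k) w
  have z2 : ∀ k, ∫ p in U, fderiv ℝ (u k) p N = 0 := fun k => by
    rw [← hredR fun p hp => hzeroR (hu0 k) hp N]
    simpa using (isC1UpTo_const M (1 : ℝ)).integral_fderiv_smul_eq_zero (μ := volume) hM (hu k)
      (husupp k) N
  have key : ∀ k, ‖∫ p in U, ramp g k p • fderiv ℝ (fun q => φ q • f q) p w‖ ≤
      2 * δ * ‖w‖ * A * ∫ p in U, ramp g k p * fderiv ℝ φ p N := by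
    intro k
    have e1 : ∫ p in U, ramp g k p • fderiv ℝ (fun q => φ q • f q) p w =
        ∫ p in U, (ramp g k p • fderiv ℝ (fun q => φ q • f q) p w -
          fderiv ℝ (fun q => u k q • f q) p w) := by
      rw [integral_sub (irF k) (iuf k), z1, sub_zero]
    have e2 : ∫ p in U, ramp g k p * fderiv ℝ φ p N =
        ∫ p in U, (ramp g k p * fderiv ℝ φ p N - fderiv ℝ (u k) p N) := by
      rw [integral_sub (irφ k) (iu k), z2, sub_zero]
    rw [e1, e2, ← integral_const_mul]
    refine norm_integral_le_of_norm_le (((irφ k).sub (iu k)).const_mul _) ?_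
    refine (ae_restrict_iff' hUo.measurableSet).2 (Eventually.of_forall fun p hp => ?_)
    have hpM := interior_subset hp.1
    have e3 : ramp g k p • fderiv ℝ (fun q => φ q • f q) p w -
        fderiv ℝ (fun q => u k q • f q) p w = (φ p * (s k p * fderiv ℝ g p w)) • f p := by
      rw [hf.fderiv_smul_apply hφ hp.1, hf.fderiv_smul_apply (hu k) hp.1, hdu k p hp.2]
      simp only [u]
      module
    have e4 : ramp g k p * fderiv ℝ φ p N - fderiv ℝ (u k) p N =
        φ p * (s k p * fderiv ℝ g p N) := by
      rw [hdu k p hp.2]; ring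
    rw [e3, e4, norm_smul, Real.norm_eq_abs, abs_mul, abs_mul, abs_of_nonneg (hφ0 p),
      abs_of_nonneg (hs0 k p)]
    have h1 := c.tangential_slope_le (hball p hp.2) hw
    calc φ p * (s k p * |fderiv ℝ g p w|) * ‖f p‖
        ≤ φ p * (s k p * (2 * δ * ‖w‖ * fderiv ℝ g p N)) * A := by
          have := hφ0 p
          have := hs0 k p
          have := (abs_nonneg _).trans h1
          gcongr
          exact hA p hpM
      _ = _ := by ring
  have hlim : ∀ p ∈ U, Tendsto (fun k => ramp g k p) atTop (𝓝 1) := fun p hp =>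
    tendsto_ramp ((c.mem_interior_iff (hball p hp.2)).1 hp.1)
  have t1 : Tendsto (fun k => ∫ p in U, ramp g k p • fderiv ℝ (fun q => φ q • f q) p w) atTop
      (𝓝 (∫ p in U, fderiv ℝ (fun q => φ q • f q) p w)) := by
    refine tendsto_integral_of_dominated_convergence
      (fun p => ‖fderiv ℝ (fun q => φ q • f q) p w‖) (fun k => (irF k).aestronglyMeasurable) iF.norm
      (fun k => Eventually.of_forall fun p => ?_) ?_
    · rw [norm_smul]
      exact mul_le_of_le_one_left (norm_nonneg _) (hrb k p)
    · refine (ae_restrict_iff' hUo.measurableSet).2 (Eventually.of_forall fun p hp => ?_)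
      simpa using (hlim p hp).smul_const (fderiv ℝ (fun q => φ q • f q) p w)
  have t2 : Tendsto (fun k => ∫ p in U, ramp g k p * fderiv ℝ φ p N) atTop
      (𝓝 (∫ p in U, fderiv ℝ φ p N)) := by
    refine tendsto_integral_of_dominated_convergence
      (fun p => ‖fderiv ℝ φ p N‖) (fun k => (irφ k).aestronglyMeasurable) iφ.norm
      (fun k => Eventually.of_forall fun p => ?_) ?_
    · rw [norm_mul]
      exact mul_le_of_le_one_left (norm_nonneg _) (hrb k p)
    · refine (ae_restrict_iff' hUo.measurableSet).2 (Eventually.of_forall fun p hp => ?_)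
      simpa using (hlim p hp).mul_const (fderiv ℝ φ p N)
  rw [hred fun p hp => hzero (fun _ => id) hp w, hredR fun p hp => hzeroR (fun _ => id) hp N]
  exact le_of_tendsto_of_tendsto' t1.norm (t2.const_mul _) key

/-- The divergence theorem in a flat chart, up to an error of the order of the slope. -/
lemma norm_integral_fderiv_sub_le (c : IsFlatChart M g x N r δ h) (hE : finrank ℝ E = 3)
    (hM : IsCompact M) (hfin : μHE[2] (frontier M) < ⊤)
    {φ : E → ℝ} (hφ : ContDiff ℝ 1 φ) (hφ0 : ∀ p, 0 ≤ φ p) (hsupp : tsupport φ ⊆ cylinder x N r)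
    {f : E → W} (hf : IsC1UpTo M f) {A : ℝ} (hA0 : 0 ≤ A) (hA : ∀ p ∈ M, ‖f p‖ ≤ A) {ν : E → E}
    (hνm : AEStronglyMeasurable ν ((μHE[2]).restrict (frontier M)))
    (hν : ∀ p ∈ frontier M ∩ cylinder x N r, ‖ν p - N‖ ≤ 2 * δ) (v : E) :
    ‖(∫ p in interior M, fderiv ℝ (fun q => φ q • f q) p v) -
        ∫ p in frontier M, inner ℝ v (ν p) • φ p • f p ∂μHE[2]‖ ≤
      12 * δ * ‖v‖ * A * ∫ p in frontier M, φ p ∂μHE[2] := by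
  have hN := c.norm_normal
  have hδ0 := c.slope_nonneg
  have hMc := hM.isClosed
  have hfr : IsClosed (frontier M) := isClosed_frontier
  have hfrM : frontier M ⊆ M := hMc.frontier_subset
  set B : Set E := frontier M ∩ cylinder x N r with hB
  have hBm : MeasurableSet B := hfr.measurableSet.inter (isOpen_cylinder x N r).measurableSet
  have hBM : B ⊆ M := inter_subset_left.trans hfrM
  set σ : Measure E := (μHE[2]).restrict B with hσ
  set τ : Measure E := c.projMeasure with hτ
  have hσfin : IsFiniteMeasure σ := ⟨by
    rw [hσ, Measure.restrict_apply_univ]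
    exact (measure_mono inter_subset_left).trans_lt hfin⟩
  have hσle : σ ≤ (μHE[2]).restrict (frontier M) := Measure.restrict_mono inter_subset_left le_rfl
  have hτσ : τ ≤ σ := c.projMeasure_le hE hMc
  have hστ : σ ≤ ENNReal.ofReal (1 + 8 * δ) • τ := c.restrict_le_smul_projMeasure hE hMc
  set F : E → W := fun p => φ p • f p with hF
  have hFC : IsC1UpTo M F := hf.smul hM hφ
  have hφC : IsC1UpTo M φ := isC1UpTo_of_contDiffOn hM hφ.contDiffOn
  have hFφ : ∀ p ∈ M, ‖F p‖ ≤ A * φ p := fun p hp => by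
    rw [hF, norm_smul, Real.norm_of_nonneg (hφ0 p), mul_comm]
    exact mul_le_mul_of_nonneg_right (hA p hp) (hφ0 p)
  have iφ : Integrable φ σ := by
    obtain ⟨C, hC⟩ := hM.exists_bound_of_continuousOn hφ.continuous.continuousOn
    exact Integrable.of_bound hφ.continuous.aestronglyMeasurable C
      ((ae_restrict_iff' hBm).2 (Eventually.of_forall fun p hp => hC p (hBM hp)))
  have iF : Integrable F σ := (iφ.const_mul A).mono'
    ((hFC.continuousOn.mono hBM).aestronglyMeasurable hBm)
    ((ae_restrict_iff' hBm).2 (Eventually.of_forall fun p hp => hFφ p (hBM hp)))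
  have iφτ : Integrable φ τ := iφ.mono_measure hτσ
  have iFτ : Integrable F τ := iF.mono_measure hτσ
  set Φ := ∫ p, φ p ∂σ with hΦ
  set Φ' := ∫ p, φ p ∂τ with hΦ'
  have hΦ'0 : 0 ≤ Φ' := integral_nonneg hφ0
  have hΦ'Φ : Φ' ≤ Φ := integral_mono_measure hτσ (Eventually.of_forall hφ0) iφ
  have hΦΦ' : Φ ≤ (1 + 8 * δ) * Φ' := by
    have h1 := integral_mono_measure hστ (Eventually.of_forall hφ0)
      (iφτ.smul_measure ENNReal.ofReal_ne_top)
    rwa [integral_smul_measure, ENNReal.toReal_ofReal (by positivity), smul_eq_mul] at h1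
  -- Area `σ` and projected area `τ` satisfy `τ ≤ σ ≤ (1 + 8 δ) τ`, so `φ` has integral `Φ - Φ' ≤ 8
  -- δ Φ` against the positive measure `σ - τ`.
  have hdiff : ‖∫ p, F p ∂τ - ∫ p, F p ∂σ‖ ≤ 8 * δ * A * Φ := by
    have hadd : σ - τ + τ = σ := Measure.sub_add_cancel_of_le hτσ
    have hρ : σ - τ ≤ σ := Measure.sub_le
    have e1 : ∫ p, F p ∂σ = ∫ p, F p ∂(σ - τ) + ∫ p, F p ∂τ := by
      conv_lhs => rw [← hadd]
      exact integral_add_measure (iF.mono_measure hρ) iFτ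
    have e2 : Φ = ∫ p, φ p ∂(σ - τ) + Φ' := by
      rw [hΦ]
      conv_lhs => rw [← hadd]
      exact integral_add_measure (iφ.mono_measure hρ) iφτ
    rw [e1, sub_add_cancel_right, norm_neg]
    calc ‖∫ p, F p ∂(σ - τ)‖ ≤ ∫ p, A * φ p ∂(σ - τ) := by
          refine norm_integral_le_of_norm_le ((iφ.mono_measure hρ).const_mul A) ?_
          refine ae_mono hρ ((ae_restrict_iff' hBm).2 (Eventually.of_forall fun p hp => ?_))
          exact hFφ p (hBM hp)
      _ = A * (Φ - Φ') := by rw [integral_const_mul, e2, add_sub_cancel_right]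
      _ ≤ A * (8 * δ * Φ) := by
          gcongr
          nlinarith
      _ = 8 * δ * A * Φ := by ring
  have hFN : ∫ p in interior M, fderiv ℝ F p N = ∫ p, F p ∂τ := by
    rw [c.integral_fderiv_normal hM hFC (isClosed_tsupport φ) hsupp fun p _ hp => by
      simp only [hF]; rw [image_eq_zero_of_notMem_tsupport hp, zero_smul]]
    exact (integral_map c.aemeasurable_graph iFτ.aestronglyMeasurable).symm
  have hφN : ∫ p in interior M, fderiv ℝ φ p N = Φ' := by
    rw [c.integral_fderiv_normal hM hφC (isClosed_tsupport φ) hsupp fun p _ hp =>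
      image_eq_zero_of_notMem_tsupport hp]
    exact (integral_map c.aemeasurable_graph iφτ.aestronglyMeasurable).symm
  -- Splitting `v = a N + w`: the first part is handled exactly with `τ`, the second by the
  -- tangential estimate.
  set w : E := ((Hyp N).orthogonalProjectionOnto v : E) with hw
  set a : ℝ := inner ℝ N v with ha
  have hv : v = a • N + w := by
    have h := Submodule.starProjection_add_starProjection_orthogonal (K := ℝ ∙ N) v
    rw [Submodule.starProjection_unit_singleton ℝ hN] at h
    exact h.symm
  have hwN : inner ℝ N w = 0 := inner_Hyp _
  have hwv : ‖w‖ ≤ ‖v‖ := (Hyp N).norm_orthogonalProjectionOnto_apply_le v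
  have hav : |a| ≤ ‖v‖ := by
    have := abs_real_inner_le_norm N v
    rwa [hN, one_mul] at this
  have htan := c.norm_integral_fderiv_tangential_le hM hφ hφ0 hsupp hf hA hwN
  rw [hφN] at htan
  have hLHS : ∫ p in interior M, fderiv ℝ F p v =
      a • ∫ p, F p ∂τ + ∫ p in interior M, fderiv ℝ F p w := by
    have i0 : Integrable (fun p => a • fderiv ℝ F p N) (volume.restrict (interior M)) :=
      (hFC.integrableOn_fderiv hM N).smul a
    rw [← hFN, ← integral_smul, ← integral_add i0 (hFC.integrableOn_fderiv hM w)]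
    refine integral_congr_ae (Eventually.of_forall fun p => ?_)
    simp only
    conv_lhs => rw [hv, map_add, map_smul]
  have i1 : Integrable (fun p => inner ℝ v (ν p - N) • F p) σ := by
    refine iF.bdd_smul (‖v‖ * (2 * δ)) ?_ ?_
    · have h1 : AEStronglyMeasurable (fun p => ν p - N) σ :=
        (hνm.mono_measure hσle).sub aestronglyMeasurable_const
      exact aestronglyMeasurable_const.inner h1
    · refine (ae_restrict_iff' hBm).2 (Eventually.of_forall fun p hp => ?_)
      exact (norm_inner_le_norm v _).trans (by gcongr; exact hν p hp)
  have hRHS : ∫ p in frontier M, inner ℝ v (ν p) • φ p • f p ∂μHE[2] =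
      a • ∫ p, F p ∂σ + ∫ p, inner ℝ v (ν p - N) • F p ∂σ := by
    have e1 : ∫ p in frontier M, inner ℝ v (ν p) • φ p • f p ∂μHE[2] =
        ∫ p in B, inner ℝ v (ν p) • φ p • f p ∂μHE[2] := by
      apply setIntegral_eq_of_subset_of_forall_sdiff_eq_zero hfr.measurableSet inter_subset_left
      intro p hp
      rw [image_eq_zero_of_notMem_tsupport fun H => hp.2 ⟨hp.1, hsupp H⟩, zero_smul, smul_zero]
    have i0 : Integrable (fun p => a • F p) σ := iF.smul a
    rw [e1, ← integral_smul, ← integral_add i0 i1]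
    refine integral_congr_ae (Eventually.of_forall fun p => ?_)
    simp only [hF]
    rw [← add_smul, inner_sub_right, ha, real_inner_comm v N, add_sub_cancel]
  have hΦfr : ∫ p in frontier M, φ p ∂μHE[2] = Φ := by
    apply setIntegral_eq_of_subset_of_forall_sdiff_eq_zero hfr.measurableSet inter_subset_left
    intro p hp
    exact image_eq_zero_of_notMem_tsupport fun H => hp.2 ⟨hp.1, hsupp H⟩
  have hlast : ‖∫ p, inner ℝ v (ν p - N) • F p ∂σ‖ ≤ 2 * δ * ‖v‖ * A * Φ := by
    calc _ ≤ ∫ p, ‖v‖ * (2 * δ) * (A * φ p) ∂σ := by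
          refine norm_integral_le_of_norm_le ((iφ.const_mul A).const_mul _) ?_
          refine (ae_restrict_iff' hBm).2 (Eventually.of_forall fun p hp => ?_)
          rw [norm_smul]
          have h1 : ‖inner ℝ v (ν p - N)‖ ≤ ‖v‖ * (2 * δ) :=
            (norm_inner_le_norm v _).trans (by gcongr; exact hν p hp)
          exact mul_le_mul h1 (hFφ p (hBM hp)) (norm_nonneg _) ((norm_nonneg _).trans h1)
      _ = 2 * δ * ‖v‖ * A * Φ := by
          rw [integral_const_mul, integral_const_mul]; ring
  rw [hRHS, hΦfr, hLHS]
  calc _ = ‖a • (∫ p, F p ∂τ - ∫ p, F p ∂σ) + (∫ p in interior M, fderiv ℝ F p w) -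
        ∫ p, inner ℝ v (ν p - N) • F p ∂σ‖ := by
        congr 1
        module
    _ ≤ |a| * ‖∫ p, F p ∂τ - ∫ p, F p ∂σ‖ + ‖∫ p in interior M, fderiv ℝ F p w‖ +
        ‖∫ p, inner ℝ v (ν p - N) • F p ∂σ‖ := by
        refine (norm_sub_le _ _).trans (add_le_add ((norm_add_le _ _).trans ?_) le_rfl)
        rw [norm_smul, Real.norm_eq_abs]
    -- The constant is 12 = 8 + 2 + 2: area against projected area, the tangential derivative, and
    -- the variation of the normal.
    _ ≤ ‖v‖ * (8 * δ * A * Φ) + 2 * δ * ‖v‖ * A * Φ + 2 * δ * ‖v‖ * A * Φ := by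
        refine add_le_add (add_le_add ?_ (htan.trans ?_)) hlast
        · exact mul_le_mul hav hdiff (norm_nonneg _) (norm_nonneg _)
        · gcongr
    _ = _ := by ring

end IsFlatChart

/-! ### The outward unit normal -/

lemma fderiv_eq_innerSL_gradient (g : E3 → ℝ) (x : E3) : fderiv ℝ g x = innerSL ℝ (∇ g x) :=
  ((InnerProductSpace.toDual ℝ E3).apply_symm_apply (fderiv ℝ g x)).symm

lemma IsOutwardUnitNormal.norm_eq_one {M : Set E3} {x n : E3} (h : IsOutwardUnitNormal M x n) :
    ‖n‖ = 1 := by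
  obtain ⟨g, -, -, h0, -, rfl⟩ := h
  rw [norm_smul, norm_inv, norm_norm, inv_mul_cancel₀ (norm_ne_zero_iff.2 h0)]

/-- A defining function whose gradient at the point is the unit normal. -/
lemma IsOutwardUnitNormal.exists_normalized {M : Set E3} {x n : E3}
    (h : IsOutwardUnitNormal M x n) : ∃ g : E3 → ℝ, ContDiffAt ℝ 1 g x ∧ g x = 0 ∧
      fderiv ℝ g x = innerSL ℝ n ∧ ∀ᶠ y in 𝓝 x, y ∈ M ↔ g y ≤ 0 := by
  obtain ⟨g, hg, hx, h0, hM, rfl⟩ := h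
  have hpos : 0 < ‖∇ g x‖⁻¹ := inv_pos.2 (norm_pos_iff.2 h0)
  refine ⟨fun y => ‖∇ g x‖⁻¹ * g y, contDiffAt_const.mul hg, by simp [hx], ?_, ?_⟩
  · rw [fderiv_const_mul (hg.differentiableAt one_ne_zero), fderiv_eq_innerSL_gradient, map_smul]
  · filter_upwards [hM] with y hy
    rw [hy, mul_nonpos_iff_pos_imp_nonpos]
    exact ⟨fun H => ⟨fun _ => H, fun _ => hpos.le⟩, fun H => H.1 hpos⟩

lemma IsOutwardUnitNormal.exists_isFlatChart {M : Set E3} {x n : E3}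
    (h : IsOutwardUnitNormal M x n) {δ : ℝ} (hδ0 : 0 < δ) (hδ1 : δ ≤ 1 / 2) :
    ∃ g r k, IsFlatChart M g x n r δ k := by
  obtain ⟨g, hg, hx, hd, hM⟩ := h.exists_normalized
  exact ⟨g, GeomCalc.exists_isFlatChart h.norm_eq_one hδ0 hδ1 hg hx hd hM⟩

lemma eventually_pos_of_hasFDerivAt {g : E3 → ℝ} {x n v : E3} (hg : HasFDerivAt g (innerSL ℝ n) x)
    (hx : g x = 0) (hv : 0 < inner ℝ n v) : ∀ᶠ t : ℝ in 𝓝[>] 0, 0 < g (x + t • v) := by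
  have h1 : HasDerivAt (fun t : ℝ => g (x + t • v)) (inner ℝ n v) 0 := by
    have hl : HasDerivAt (fun t : ℝ => x + t • v) v 0 := by
      simpa using ((hasDerivAt_id (0 : ℝ)).smul_const v).const_add x
    have hg' : HasFDerivAt g (innerSL ℝ n) (x + (0 : ℝ) • v) := by simpa using hg
    exact hg'.comp_hasDerivAt 0 hl
  have h2 := (hasDerivAt_iff_tendsto_slope.1 h1).eventually (lt_mem_nhds hv)
  filter_upwards [h2.filter_mono (nhdsWithin_mono _ fun t (ht : 0 < t) => ht.ne'),
    self_mem_nhdsWithin] with t ht ht0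
  rw [slope_def_field, zero_smul, add_zero, hx, sub_zero, sub_zero] at ht
  exact (div_pos_iff_of_pos_right ht0).1 ht

/-- If `n ≠ n'`, a small step in direction `n' - n` lowers `g` and raises `g'` at first order. The
point reached is in `M` by the first description and outside by the second. -/
lemma IsOutwardUnitNormal.unique {M : Set E3} {x n n' : E3} (h : IsOutwardUnitNormal M x n)
    (h' : IsOutwardUnitNormal M x n') : n = n' := by
  by_contra hne
  obtain ⟨g, hg, hx, hd, hM⟩ := h.exists_normalized
  obtain ⟨g', hg', hx', hd', hM'⟩ := h'.exists_normalized
  have hlt : inner ℝ n n' < 1 := by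
    refine lt_of_le_of_ne ?_ fun H => hne ?_
    · simpa [h.norm_eq_one, h'.norm_eq_one] using real_inner_le_norm n n'
    · exact (inner_eq_one_iff_of_norm_eq_one (𝕜 := ℝ) h.norm_eq_one h'.norm_eq_one).1 H
  have hD : HasFDerivAt g (innerSL ℝ n) x := hd ▸ (hg.differentiableAt one_ne_zero).hasFDerivAt
  have hD' : HasFDerivAt g' (innerSL ℝ n') x :=
    hd' ▸ (hg'.differentiableAt one_ne_zero).hasFDerivAt
  have hDn : HasFDerivAt (fun y => -g y) (innerSL ℝ (-n)) x := by
    rw [map_neg]; exact hD.neg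
  have e1 := eventually_pos_of_hasFDerivAt (v := n' - n) hDn (by simp [hx]) (by
    rw [inner_neg_left, inner_sub_right, real_inner_self_eq_norm_sq, h.norm_eq_one]
    linarith)
  have e2 := eventually_pos_of_hasFDerivAt (v := n' - n) hD' hx' (by
    rw [inner_sub_right, real_inner_self_eq_norm_sq, h'.norm_eq_one, real_inner_comm]
    linarith)
  have hl : Tendsto (fun t : ℝ => x + t • (n' - n)) (𝓝[>] 0) (𝓝 x) := by
    have : Continuous fun t : ℝ => x + t • (n' - n) := by fun_prop
    simpa using (this.tendsto 0).mono_left (nhdsWithin_le_nhds (s := Ioi 0))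
  obtain ⟨t, ⟨⟨ht1, ht2⟩, ht3⟩, ht4⟩ :=
    (((e1.and e2).and (hl.eventually hM)).and (hl.eventually hM')).exists
  exact absurd (ht4.1 (ht3.2 (by linarith))) (not_le.2 ht2)

lemma outwardNormal_eq {M : Set E3} {x n : E3} (h : IsOutwardUnitNormal M x n) :
    outwardNormal M x = n := by
  have hex : ∃ n, IsOutwardUnitNormal M x n := ⟨n, h⟩
  rw [outwardNormal, dif_pos hex]
  exact hex.choose_spec.unique h

lemma isOutwardUnitNormal_outwardNormal {M : Set E3} {x : E3} (h : x ∈ smoothBoundary M) :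
    IsOutwardUnitNormal M x (outwardNormal M x) := by
  obtain ⟨n, hn⟩ := h
  rwa [outwardNormal_eq hn]

lemma norm_outwardNormal_le (M : Set E3) (x : E3) : ‖outwardNormal M x‖ ≤ 1 := by
  by_cases h : ∃ n, IsOutwardUnitNormal M x n
  · exact (isOutwardUnitNormal_outwardNormal h).norm_eq_one.le
  · simp [outwardNormal, h]

/-- The function `g` of the chart also describes `M` at nearby boundary points, with normal `∇g /
‖∇g‖`. One `δ` compares `∇g` with `N`, the other pays for normalizing. -/
lemma IsFlatChart.isOutwardUnitNormal {M : Set E3} {g : E3 → ℝ} {x N : E3} {r δ : ℝ}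
    {h : Hyp N → ℝ} (c : IsFlatChart M g x N r δ h) (hM : IsClosed M) {p : E3}
    (hp : p ∈ frontier M ∩ cylinder x N r) :
    p ∈ smoothBoundary M ∧ ‖outwardNormal M p - N‖ ≤ 2 * δ := by
  have hb := cylinder_subset_ball c.norm_normal hp.2
  have hnb := isOpen_ball.mem_nhds hb
  have hd : ‖∇ g p - N‖ ≤ δ := by
    have := c.norm_fderiv_sub_le p hb
    rwa [fderiv_eq_innerSL_gradient, ← map_sub, innerSL_apply_norm] at this
  have hn : |‖∇ g p‖ - 1| ≤ δ := by
    have := (abs_norm_sub_norm_le (∇ g p) N).trans hd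
    rwa [c.norm_normal] at this
  have hpos : 0 < ‖∇ g p‖ := by linarith [(abs_le.1 hn).1, c.slope_le]
  have hN : IsOutwardUnitNormal M p (‖∇ g p‖⁻¹ • ∇ g p) :=
    ⟨g, c.contDiffOn.contDiffAt hnb, (c.mem_frontier_iff hM hb).1 hp.1, norm_pos_iff.1 hpos,
      by filter_upwards [hnb] with q hq using c.mem_iff q hq, rfl⟩
  refine ⟨⟨_, hN⟩, ?_⟩
  rw [outwardNormal_eq hN]
  have h1 : ‖‖∇ g p‖⁻¹ • ∇ g p - ∇ g p‖ ≤ δ := by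
    have : ‖∇ g p‖⁻¹ • ∇ g p - ∇ g p = (‖∇ g p‖⁻¹ - 1) • ∇ g p := by rw [sub_smul, one_smul]
    rw [this, norm_smul, Real.norm_eq_abs, ← abs_of_pos hpos, ← abs_mul, abs_of_pos hpos, sub_mul,
      inv_mul_cancel₀ hpos.ne', one_mul, abs_sub_comm]
    exact hn
  calc _ ≤ ‖‖∇ g p‖⁻¹ • ∇ g p - ∇ g p‖ + ‖∇ g p - N‖ := norm_sub_le_norm_sub_add_norm_sub _ _ _
    _ ≤ 2 * δ := by linarith

/-- At an interior point of `M` the defining function would have a local maximum, against its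
nonzero gradient. -/
lemma smoothBoundary_subset_frontier {M : Set E3} (hM : IsClosed M) :
    smoothBoundary M ⊆ frontier M := by
  rintro x ⟨n, hn⟩
  obtain ⟨g, hg, hx, hd, hMg⟩ := hn.exists_normalized
  rw [hM.frontier_eq]
  refine ⟨hMg.self_of_nhds.2 hx.le, fun hxi => ?_⟩
  have hmax : IsLocalMax g x := by
    filter_upwards [hMg, isOpen_interior.mem_nhds hxi] with q hq hqi
    rw [hx]
    exact hq.1 (interior_subset hqi)
  have h1 : ‖innerSL ℝ n‖ = 0 := by rw [← hd, hmax.fderiv_eq_zero, norm_zero]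
  rw [innerSL_apply_norm, hn.norm_eq_one] at h1
  exact one_ne_zero h1

lemma continuousOn_outwardNormal {M : Set E3} (hM : IsClosed M) :
    ContinuousOn (outwardNormal M) (smoothBoundary M) := by
  intro x hx
  rw [ContinuousWithinAt, Metric.tendsto_nhds]
  intro ε hε
  obtain ⟨g, r, k, c⟩ := (isOutwardUnitNormal_outwardNormal hx).exists_isFlatChart
    (show 0 < min (ε / 3) (1 / 2) by positivity) (min_le_right _ _)
  filter_upwards [self_mem_nhdsWithin, mem_nhdsWithin_of_mem_nhds ((isOpen_cylinder x _ r).mem_nhds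
    (mem_cylinder_self x _ c.radius_pos))] with p hp hpc
  rw [dist_eq_norm]
  have := (c.isOutwardUnitNormal hM ⟨smoothBoundary_subset_frontier hM hp, hpc⟩).2
  have := min_le_left (ε / 3) (1 / 2)
  linarith

/-- A chart shows that smoothness persists at nearby boundary points. Closedness gives the
compactness needed to cover the singular set by finitely many balls. -/
lemma isClosed_frontier_sdiff_smoothBoundary {M : Set E3} (hM : IsClosed M) :
    IsClosed (frontier M \ smoothBoundary M) := by
  rw [← isOpen_compl_iff, isOpen_iff_mem_nhds]
  intro x hx
  by_cases hxf : x ∈ frontier M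
  · have hxs : x ∈ smoothBoundary M := by_contra fun H => hx ⟨hxf, H⟩
    obtain ⟨g, r, k, c⟩ := (isOutwardUnitNormal_outwardNormal hxs).exists_isFlatChart
      one_half_pos le_rfl
    filter_upwards [(isOpen_cylinder x _ r).mem_nhds (mem_cylinder_self x _ c.radius_pos)] with p hp
    exact fun H => H.2 (c.isOutwardUnitNormal hM ⟨H.1, hp⟩).1
  · filter_upwards [isClosed_frontier.isOpen_compl.mem_nhds hxf] with p hp
    exact fun H => hp H.1

/-! ### Regions -/

namespace IsRegion

variable {M : Set E3}

lemma isClosed (hM : IsRegion M) : IsClosed M := hM.isCompact.isClosed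

lemma isFiniteMeasure (hM : IsRegion M) : IsFiniteMeasure (surfaceMeasure M) :=
  ⟨by rw [surfaceMeasure, Measure.restrict_apply_univ]; exact hM.area_lt_top⟩

/-- Finite two-dimensional measure forces zero three-dimensional measure, so volume integrals over
`M` may be taken over its interior, where derivatives are under control. -/
lemma volume_frontier (hM : IsRegion M) : volume (frontier M) = 0 := by
  rw [← EuclideanSpace.euclideanHausdorffMeasure_eq_volume 3]
  exact (Measure.euclideanHausdorffMeasure_zero_or_top (show 2 < 3 by norm_num)
    (frontier M)).resolve_right hM.area_lt_top.ne

lemma interior_ae_eq (hM : IsRegion M) : (interior M : Set E3) =ᵐ[volume] M :=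
  interior_ae_eq_of_null_frontier hM.volume_frontier

lemma isCompact_singular (hM : IsRegion M) : IsCompact (frontier M \ smoothBoundary M) :=
  hM.isCompact.of_isClosed_subset (isClosed_frontier_sdiff_smoothBoundary hM.isClosed)
    (sdiff_subset.trans hM.isClosed.frontier_subset)

lemma ae_mem_smoothBoundary (hM : IsRegion M) :
    ∀ᵐ x ∂(surfaceMeasure M), x ∈ smoothBoundary M := by
  rw [surfaceMeasure, ae_restrict_iff' isClosed_frontier.measurableSet, ae_iff]
  refine measure_mono_null (fun x hx => ?_) hM.area_singular
  simp only [mem_ofPred_eq, Classical.not_imp] at hx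
  exact hx

lemma aestronglyMeasurable_outwardNormal (hM : IsRegion M) :
    AEStronglyMeasurable (outwardNormal M) (surfaceMeasure M) := by
  have hs : smoothBoundary M = frontier M \ (frontier M \ smoothBoundary M) :=
    (sdiff_sdiff_eq_self (smoothBoundary_subset_frontier hM.isClosed)).symm
  have hms : MeasurableSet (smoothBoundary M) := by
    rw [hs]
    exact isClosed_frontier.measurableSet.diff
      (isClosed_frontier_sdiff_smoothBoundary hM.isClosed).measurableSet
  have h1 : (surfaceMeasure M).restrict (smoothBoundary M) = surfaceMeasure M :=
    Measure.restrict_eq_self_of_ae_mem hM.ae_mem_smoothBoundary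
  rw [← h1]
  exact (continuousOn_outwardNormal hM.isClosed).aestronglyMeasurable hms

variable {W : Type*} [NormedAddCommGroup W] [NormedSpace ℝ W]

omit [NormedSpace ℝ W] in
lemma integrable_surface (hM : IsRegion M) {f : E3 → W} (hf : ContinuousOn f M) :
    Integrable f (surfaceMeasure M) := by
  have := hM.isFiniteMeasure
  obtain ⟨C, hC⟩ := hM.isCompact.exists_bound_of_continuousOn hf
  have hfr := hM.isClosed.frontier_subset
  exact Integrable.of_bound
    ((hf.mono hfr).aestronglyMeasurable isClosed_frontier.measurableSet) C
    ((ae_restrict_iff' isClosed_frontier.measurableSet).2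
      (Eventually.of_forall fun p hp => hC p (hfr hp)))

lemma integrable_inner_normal_smul (hM : IsRegion M) {f : E3 → W} (hf : ContinuousOn f M) (v : E3) :
    Integrable (fun x => inner ℝ v (outwardNormal M x) • f x) (surfaceMeasure M) := by
  refine (hM.integrable_surface hf).bdd_smul ‖v‖
    (aestronglyMeasurable_const.inner hM.aestronglyMeasurable_outwardNormal)
    (Eventually.of_forall fun x => ?_)
  exact (norm_inner_le_norm v _).trans
    (mul_le_of_le_one_right (norm_nonneg _) (norm_outwardNormal_le M x))

end IsRegion

/-! ### The divergence theorem on a region -/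

namespace IsRegion

variable {M : Set E3} {W : Type*} [NormedAddCommGroup W] [NormedSpace ℝ W] [CompleteSpace W]

/-- Away from the singular set, the divergence theorem holds locally up to a small error. -/
lemma exists_local_flux_bound (hM : IsRegion M) {f : E3 → W} (hf : IsC1UpTo M f) {A : ℝ}
    (hA0 : 0 ≤ A) (hA : ∀ p ∈ M, ‖f p‖ ≤ A) (v : E3) {δ : ℝ} (hδ0 : 0 < δ) (hδ1 : δ ≤ 1 / 2)
    {x : E3} (hx : x ∉ frontier M \ smoothBoundary M) :
    ∃ U, IsOpen U ∧ x ∈ U ∧ ∀ φ : E3 → ℝ, ContDiff ℝ 1 φ → (∀ p, 0 ≤ φ p) → tsupport φ ⊆ U →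
      ‖(∫ p in interior M, fderiv ℝ (fun q => φ q • f q) p v) -
        ∫ p, inner ℝ v (outwardNormal M p) • φ p • f p ∂(surfaceMeasure M)‖ ≤
      12 * δ * ‖v‖ * A * ∫ p, φ p ∂(surfaceMeasure M) := by
  have hfr := hM.isClosed.frontier_subset
  have hnonneg {φ : E3 → ℝ} (h0 : ∀ p, 0 ≤ φ p) :
      0 ≤ 12 * δ * ‖v‖ * A * ∫ p, φ p ∂(surfaceMeasure M) := by
    have := integral_nonneg (μ := surfaceMeasure M) (show (0 : E3 → ℝ) ≤ φ from h0)
    positivity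
  have hsurf {φ : E3 → ℝ} (h0 : ∀ p ∈ frontier M, φ p = 0) :
      ∫ p, inner ℝ v (outwardNormal M p) • φ p • f p ∂(surfaceMeasure M) = 0 := by
    refine setIntegral_eq_zero_of_forall_eq_zero fun p hp => ?_
    rw [h0 p hp, zero_smul, smul_zero]
  -- Three cases: interior points and points outside `M`, where both integrals vanish, and smooth
  -- boundary points, where a chart applies.
  by_cases hxi : x ∈ interior M
  · refine ⟨interior M, isOpen_interior, hxi, fun φ hφ h0 hs => ?_⟩
    rw [hf.integral_fderiv_smul_eq_zero hM.isCompact hφ hs v, hsurf, sub_zero, norm_zero]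
    · exact hnonneg h0
    · exact fun p hp => image_eq_zero_of_notMem_tsupport fun H => hp.2 (hs H)
  by_cases hxM : x ∈ M
  · have hxf : x ∈ frontier M := by
      rw [hM.isClosed.frontier_eq]; exact ⟨hxM, hxi⟩
    have hxs : x ∈ smoothBoundary M := by_contra fun H => hx ⟨hxf, H⟩
    obtain ⟨g, r, k, c⟩ := (isOutwardUnitNormal_outwardNormal hxs).exists_isFlatChart hδ0 hδ1
    refine ⟨cylinder x (outwardNormal M x) r, isOpen_cylinder _ _ _,
      mem_cylinder_self _ _ c.radius_pos, fun φ hφ h0 hs => ?_⟩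
    exact c.norm_integral_fderiv_sub_le (by simp) hM.isCompact hM.area_lt_top hφ h0 hs hf hA0 hA
      hM.aestronglyMeasurable_outwardNormal (fun p hp => (c.isOutwardUnitNormal hM.isClosed hp).2) v
  · refine ⟨Mᶜ, hM.isClosed.isOpen_compl, hxM, fun φ hφ h0 hs => ?_⟩
    have hz : ∀ p ∈ M, φ p = 0 := fun p hp => image_eq_zero_of_notMem_tsupport fun H => hs H hp
    rw [hsurf fun p hp => hz p (hfr hp), sub_zero]
    rw [setIntegral_eq_zero_of_forall_eq_zero, norm_zero]
    · exact hnonneg h0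
    · intro p hp
      have : (fun q => φ q • f q) =ᶠ[𝓝 p] fun _ => 0 := by
        filter_upwards [isOpen_interior.mem_nhds hp] with q hq
        rw [hz q (interior_subset hq), zero_smul]
      rw [this.fderiv_eq, fderiv_fun_const]; rfl

open scoped Manifold ContDiff in
/-- The divergence theorem for fields that vanish near the singular part of the boundary. -/
lemma integral_fderiv_eq_of_disjoint (hM : IsRegion M) {f : E3 → W} (hf : IsC1UpTo M f) {K : Set E3}
    (hK : IsCompact K) (hKS : Disjoint K (frontier M \ smoothBoundary M))
    (hf0 : ∀ p ∈ M, p ∉ K → f p = 0) (v : E3) :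
    ∫ p in interior M, fderiv ℝ f p v =
      ∫ p, inner ℝ v (outwardNormal M p) • f p ∂(surfaceMeasure M) := by
  have hσ := hM.isFiniteMeasure
  have hfr := hM.isClosed.frontier_subset
  obtain ⟨A, hA0, hA⟩ := hf.bounded hM.isCompact
  -- Independent of `δ` and of the cover chosen for `δ`: the partition functions sum to at most one,
  -- so the local errors add up to at most `12 δ C`.
  set C : ℝ := ‖v‖ * A * (surfaceMeasure M).real univ
  have hbound : ∀ δ : ℝ, 0 < δ → δ ≤ 1 / 2 → ‖(∫ p in interior M, fderiv ℝ f p v) -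
      ∫ p, inner ℝ v (outwardNormal M p) • f p ∂(surfaceMeasure M)‖ ≤ 12 * δ * C := by
    intro δ hδ0 hδ1
    have hloc := fun x : K => hM.exists_local_flux_bound hf hA0 hA v hδ0 hδ1
      (Set.disjoint_left.1 hKS x.2)
    choose U hUo hxU hU using hloc
    obtain ⟨t, ht⟩ := hK.elim_finite_subcover U hUo
      fun x hx => mem_iUnion.2 ⟨⟨x, hx⟩, hxU ⟨x, hx⟩⟩
    obtain ⟨ρ, hρ⟩ := SmoothPartitionOfUnity.exists_isSubordinate 𝓘(ℝ, E3) hK.isClosed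
      (fun i : t => U i) (fun i => hUo i) (by simpa [iUnion_subtype] using ht)
    have hρc : ∀ i, ContDiff ℝ 1 (ρ i) := fun i =>
      ((ρ i).contMDiff.contDiff).of_le (by exact_mod_cast le_top)
    have hρ1 : ∀ p ∈ K, ∑ i, ρ i p = 1 := fun p hp => by
      rw [← finsum_eq_sum_of_fintype]; exact ρ.sum_eq_one hp
    have hρle : ∀ p, ∑ i, ρ i p ≤ 1 := fun p => by
      rw [← finsum_eq_sum_of_fintype]; exact ρ.sum_le_one p
    have hsum : ∀ p ∈ M, f p = ∑ i, ρ i p • f p := fun p hp => by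
      rw [← Finset.sum_smul]
      by_cases hpK : p ∈ K
      · rw [hρ1 p hpK, one_smul]
      · rw [hf0 p hp hpK, smul_zero]
    have hsm : ∀ i, IsC1UpTo M fun p => ρ i p • f p := fun i => hf.smul hM.isCompact (hρc i)
    have hL : ∫ p in interior M, fderiv ℝ f p v =
        ∑ i, ∫ p in interior M, fderiv ℝ (fun q => ρ i q • f q) p v := by
      rw [← integral_finsetSum _ fun i _ => (hsm i).integrableOn_fderiv hM.isCompact v]
      refine setIntegral_congr_fun isOpen_interior.measurableSet fun p hp => ?_
      have he : f =ᶠ[𝓝 p] fun q => ∑ i, ρ i q • f q := by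
        filter_upwards [isOpen_interior.mem_nhds hp] with q hq using hsum q (interior_subset hq)
      rw [he.fderiv_eq, fderiv_fun_sum fun i _ => (hsm i).differentiableAt p hp]
      simp
    have hR : ∫ p, inner ℝ v (outwardNormal M p) • f p ∂(surfaceMeasure M) =
        ∑ i, ∫ p, inner ℝ v (outwardNormal M p) • ρ i p • f p ∂(surfaceMeasure M) := by
      rw [← integral_finsetSum _ fun i _ =>
        hM.integrable_inner_normal_smul (hsm i).continuousOn v]
      refine setIntegral_congr_fun isClosed_frontier.measurableSet fun p hp => ?_
      rw [← Finset.smul_sum, ← hsum p (hfr hp)]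
    rw [hL, hR, ← Finset.sum_sub_distrib]
    calc _ ≤ ∑ i, 12 * δ * ‖v‖ * A * ∫ p, ρ i p ∂(surfaceMeasure M) :=
          norm_sum_le_of_le _ fun i _ => hU i (ρ i) (hρc i) (fun p => ρ.nonneg i p) (hρ i)
      _ = 12 * δ * ‖v‖ * A * ∫ p, ∑ i, ρ i p ∂(surfaceMeasure M) := by
          rw [← Finset.mul_sum, integral_finsetSum]
          exact fun i _ => hM.integrable_surface (hρc i).continuous.continuousOn
      _ ≤ 12 * δ * ‖v‖ * A * ∫ _, (1 : ℝ) ∂(surfaceMeasure M) := by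
          gcongr
          · exact integrable_finsetSum _ fun i _ =>
              hM.integrable_surface (hρc i).continuous.continuousOn
          · exact integrable_const _
          · exact hρle
      _ = 12 * δ * C := by
          rw [integral_const, smul_eq_mul, mul_one]; simp only [C]; ring
  rw [← sub_eq_zero, ← norm_le_zero_iff]
  have ht : Tendsto (fun δ : ℝ => 12 * δ * C) (𝓝[>] 0) (𝓝 0) := by
    have : Continuous fun δ : ℝ => 12 * δ * C := by fun_prop
    simpa using (this.tendsto 0).mono_left (nhdsWithin_le_nhds (s := Ioi 0))
  refine ge_of_tendsto ht ?_
  filter_upwards [Ioc_mem_nhdsGT (show (0 : ℝ) < 1 / 2 by norm_num)] with δ hδ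
  exact hbound δ hδ.1 hδ.2

/-- The divergence theorem on a region with piecewise smooth boundary, for a single partial
derivative. -/
theorem integral_interior_fderiv_eq (hM : IsRegion M) {f : E3 → W} (hf : IsC1UpTo M f) (v : E3) :
    ∫ p in interior M, fderiv ℝ f p v =
      ∫ p, inner ℝ v (outwardNormal M p) • f p ∂(surfaceMeasure M) := by
  set S := frontier M \ smoothBoundary M with hS
  have hSc : IsCompact S := hM.isCompact_singular
  -- The normalized area is a nonzero multiple of the plain Hausdorff measure.
  have hS0 : μH[2] S = 0 := by
    have h := hM.area_singular
    rw [Measure.euclideanHausdorffMeasure_def, Measure.smul_apply, ENNReal.smul_def, smul_eq_mul,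
      mul_eq_zero, ENNReal.coe_eq_zero] at h
    simpa using h.resolve_left (Measure.addHaarScalarFactor_volume_hausdorffMeasure_ne_zero 2)
  obtain ⟨A, hA0, hA⟩ := hf.bounded hM.isCompact
  have hε : ∀ k : ℕ, (0 : ℝ) < 1 / ((k : ℝ) + 1) := fun k => by positivity
  choose η hη h0 h1 hdisj hone hgrad using fun k : ℕ =>
    exists_cutoff (E := E3) (by simp) volume hSc hS0 (hε k)
  have hnorm : ∀ k p, ‖η k p‖ ≤ 1 := fun k p => by
    rw [Real.norm_of_nonneg (h0 k p)]; exact h1 k p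
  have hlim : ∀ p ∉ S, Tendsto (fun k => η k p) atTop (𝓝 1) := by
    intro p hp
    have hpos : 0 < infEDist p S := by
      rw [pos_iff_ne_zero, Ne, ← mem_closure_iff_infEDist_zero, hSc.isClosed.closure_eq]
      exact hp
    have ht : Tendsto (fun k : ℕ => ENNReal.ofReal (1 / ((k : ℝ) + 1))) atTop (𝓝 0) := by
      simpa using ENNReal.tendsto_ofReal tendsto_one_div_add_atTop_nhds_zero_nat
    refine tendsto_const_nhds.congr' ?_
    filter_upwards [ht.eventually_lt_const hpos] with k hk
    exact (hone k p fun H => absurd (mem_cthickening_iff.1 H) (not_le.2 hk)).symm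
  -- The theorem for `η k • f`, which vanishes near the singular set, expanded by the product rule.
  -- The three terms converge separately by `t1`, `t2`, `t3`.
  have hkey : ∀ k, (∫ p in interior M, η k p • fderiv ℝ f p v) +
      ∫ p in interior M, fderiv ℝ (η k) p v • f p =
      ∫ p, inner ℝ v (outwardNormal M p) • η k p • f p ∂(surfaceMeasure M) := by
    intro k
    have hsm := hf.smul hM.isCompact (hη k)
    rw [← hM.integral_fderiv_eq_of_disjoint hsm (K := tsupport (η k) ∩ M)
      (hM.isCompact.inter_left (isClosed_tsupport _)) ((hdisj k).mono_left inter_subset_left)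
      (fun p hp hpK => by
        rw [image_eq_zero_of_notMem_tsupport fun H => hpK ⟨H, hp⟩, zero_smul]) v, ← integral_add]
    · exact setIntegral_congr_fun isOpen_interior.measurableSet
        fun p hp => (hf.fderiv_smul_apply (hη k) hp v).symm
    · exact (hf.integrableOn_fderiv hM.isCompact v).bdd_smul 1
        (hη k).continuous.aestronglyMeasurable (Eventually.of_forall (hnorm k))
    · have : ContinuousOn (fun p => fderiv ℝ (η k) p v • f p) M :=
        (((hη k).continuous_fderiv one_ne_zero).clm_apply continuous_const).continuousOn.smul
          hf.continuousOn
      exact (this.integrableOn_compact hM.isCompact).mono_set interior_subset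
  have t1 : Tendsto (fun k => ∫ p in interior M, η k p • fderiv ℝ f p v) atTop
      (𝓝 (∫ p in interior M, fderiv ℝ f p v)) := by
    have hi := hf.integrableOn_fderiv (μ := volume) hM.isCompact v
    refine tendsto_integral_of_dominated_convergence (fun p => ‖fderiv ℝ f p v‖)
      (fun k => (hη k).continuous.aestronglyMeasurable.smul hi.aestronglyMeasurable) hi.norm
      (fun k => Eventually.of_forall fun p => ?_) ?_
    · rw [norm_smul]
      exact mul_le_of_le_one_left (norm_nonneg _) (hnorm k p)
    · refine (ae_restrict_iff' isOpen_interior.measurableSet).2 (Eventually.of_forall fun p hp => ?_)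
      simpa using (hlim p fun H => H.1.2 hp).smul_const (fderiv ℝ f p v)
  have t2 : Tendsto (fun k => ∫ p in interior M, fderiv ℝ (η k) p v • f p) atTop (𝓝 0) := by
    have hle : ∀ k, ‖∫ p in interior M, fderiv ℝ (η k) p v • f p‖ ≤
        ‖v‖ * A * (1 / ((k : ℝ) + 1)) := by
      intro k
      rw [← ENNReal.ofReal_le_ofReal_iff (by positivity), ofReal_norm]
      calc ‖∫ p in interior M, fderiv ℝ (η k) p v • f p‖ₑ
          ≤ ∫⁻ p in interior M, ‖fderiv ℝ (η k) p v • f p‖ₑ := enorm_integral_le_lintegral_enorm _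
        _ ≤ ∫⁻ p in interior M, ENNReal.ofReal (‖v‖ * A) * ‖fderiv ℝ (η k) p‖ₑ := by
            refine setLIntegral_mono' isOpen_interior.measurableSet fun p hp => ?_
            rw [← ofReal_norm, ← ofReal_norm, ← ENNReal.ofReal_mul (by positivity)]
            refine ENNReal.ofReal_le_ofReal ?_
            rw [norm_smul]
            calc _ ≤ ‖fderiv ℝ (η k) p‖ * ‖v‖ * A :=
                  mul_le_mul ((fderiv ℝ (η k) p).le_opNorm v) (hA p (interior_subset hp))
                    (norm_nonneg _) (by positivity)
              _ = _ := by ring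
        _ ≤ ∫⁻ p, ENNReal.ofReal (‖v‖ * A) * ‖fderiv ℝ (η k) p‖ₑ := setLIntegral_le_lintegral _ _
        _ = ENNReal.ofReal (‖v‖ * A) * ∫⁻ p, ‖fderiv ℝ (η k) p‖ₑ :=
            lintegral_const_mul' _ _ ENNReal.ofReal_ne_top
        _ ≤ ENNReal.ofReal (‖v‖ * A) * ENNReal.ofReal (1 / ((k : ℝ) + 1)) := by
            gcongr; exact hgrad k
        _ = _ := (ENNReal.ofReal_mul (by positivity)).symm
    refine squeeze_zero_norm hle ?_
    simpa using tendsto_one_div_add_atTop_nhds_zero_nat.const_mul (‖v‖ * A)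
  have t3 : Tendsto
      (fun k => ∫ p, inner ℝ v (outwardNormal M p) • η k p • f p ∂(surfaceMeasure M)) atTop
      (𝓝 (∫ p, inner ℝ v (outwardNormal M p) • f p ∂(surfaceMeasure M))) := by
    have hi := hM.integrable_inner_normal_smul hf.continuousOn v
    have hcomm : ∀ k p, inner ℝ v (outwardNormal M p) • η k p • f p =
        η k p • inner ℝ v (outwardNormal M p) • f p := fun k p => smul_comm _ _ _
    simp only [hcomm]
    refine tendsto_integral_of_dominated_convergence
      (fun p => ‖inner ℝ v (outwardNormal M p) • f p‖)
      (fun k => (hη k).continuous.aestronglyMeasurable.smul hi.aestronglyMeasurable) hi.norm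
      (fun k => Eventually.of_forall fun p => ?_) ?_
    · rw [norm_smul]
      exact mul_le_of_le_one_left (norm_nonneg _) (hnorm k p)
    -- The cutoffs tend to one only off the singular set, which has zero area.
    · filter_upwards [hM.ae_mem_smoothBoundary] with p hp
      simpa using (hlim p fun H => H.2 hp).smul_const (inner ℝ v (outwardNormal M p) • f p)
  have t4 := t1.add t2
  simp only [hkey, add_zero] at t4
  exact tendsto_nhds_unique t4 t3

end IsRegion

/-! ### The curl theorem -/

/-- The cross product with a fixed left factor as a continuous linear map. -/
def crossCLM (a : E3) : E3 →L[ℝ] E3 := (crossₗ a).toContinuousLinearMap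

lemma crossCLM_apply (a b : E3) : crossCLM a b = cross a b := rfl

/-- Reassembles the fluxes in the coordinate directions into a cross product with the normal. -/
lemma sum_cross_inner_smul (n b : E3) : ∑ i, cross (e i) (inner ℝ (e i) n • b) = cross n b := by
  have h : ∑ i, (inner ℝ (e i) n : ℝ) • e i = n := by
    simpa [e] using (EuclideanSpace.basisFun (Fin 3) ℝ).sum_repr' n
  conv_rhs => rw [← h]
  simp only [← crossₗ_apply, map_sum, map_smul, LinearMap.sum_apply, LinearMap.smul_apply]

/-- The dual `I b` of a vector `b`, as a continuous linear map. -/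
def dualBivecCLM : E3 →L[ℝ] G3 := dualBivec.toContinuousLinearMap

lemma dualBivecCLM_apply (b : E3) : dualBivecCLM b = I3 * vec b := rfl

lemma comm_areaElement (M : Set E3) (x b : E3) :
    comm (areaElement M x) (I3 * vec b) = I3 * vec (cross b (outwardNormal M x)) :=
  comm_I3_mul_vec _ _

/-- The generalized divergence of the dual of a vector field is the curl. -/
lemma dot_I3_mvDiv_dual {B : E3 → E3} {x : E3} (hB : DifferentiableAt ℝ B x) :
    dot I3 (mvDiv (fun y => I3 * vec (B y)) x) = -(I3 * vec (curl B x)) := by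
  have hd : fderiv ℝ (fun y => I3 * vec (B y)) x = dualBivecCLM ∘L fderiv ℝ B x :=
    (dualBivecCLM.hasFDerivAt.comp x hB.hasFDerivAt).fderiv
  have h : mvDiv (fun y => I3 * vec (B y)) x = vec (-curl B x) := by
    simp only [mvDiv, hd, ContinuousLinearMap.comp_apply, dualBivecCLM_apply, dot_vec_I3_mul_vec,
      curl, Finset.sum_neg_distrib, map_neg, map_sum]
  rw [h, dot_I3_vec, map_neg, mul_neg]

namespace IsRegion

variable {M : Set E3} {B : E3 → E3}

lemma integrableOn_iff_interior (hM : IsRegion M) {W : Type*} [NormedAddCommGroup W] {f : E3 → W} :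
    IntegrableOn f M ↔ IntegrableOn f (interior M) :=
  (integrableOn_congr_set_ae hM.interior_ae_eq).symm

lemma integrableOn_curl (hM : IsRegion M) (hB : IsC1UpTo M B) : IntegrableOn (curl B) M := by
  rw [hM.integrableOn_iff_interior]
  exact integrable_finsetSum _ fun i _ =>
    (crossCLM (e i)).integrable_comp (hB.integrableOn_fderiv hM.isCompact (e i))

lemma integrable_cross_outwardNormal (hM : IsRegion M) (hB : ContinuousOn B M) :
    Integrable (fun x => cross (B x) (outwardNormal M x)) (surfaceMeasure M) := by
  have h : (fun x => cross (B x) (outwardNormal M x)) = fun x =>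
      -∑ i, crossCLM (e i) (inner ℝ (e i) (outwardNormal M x) • B x) := by
    ext1 x
    simp only [crossCLM_apply]
    rw [sum_cross_inner_smul, cross_swap]
  rw [h]
  exact (integrable_finsetSum _ fun i _ =>
    (crossCLM (e i)).integrable_comp (hM.integrable_inner_normal_smul hB (e i))).neg

/-- The divergence theorem for `∂ᵢB`, under the linear map `eᵢ × ·` and summed over `i`, gives `∫ n
× B` on the boundary. -/
theorem integral_curl (hM : IsRegion M) (hB : IsC1UpTo M B) :
    ∫ x in M, curl B x = -∫ x, cross (B x) (outwardNormal M x) ∂(surfaceMeasure M) := by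
  rw [← setIntegral_congr_set hM.interior_ae_eq, ← integral_neg]
  simp only [curl, ← crossCLM_apply (e _)]
  rw [integral_finsetSum _ fun i _ =>
    (crossCLM (e i)).integrable_comp (hB.integrableOn_fderiv hM.isCompact (e i))]
  have h : ∀ i, ∫ x in interior M, crossCLM (e i) (fderiv ℝ B x (e i)) =
      ∫ x, crossCLM (e i) (inner ℝ (e i) (outwardNormal M x) • B x) ∂(surfaceMeasure M) := by
    intro i
    rw [(crossCLM (e i)).integral_comp_comm (hB.integrableOn_fderiv hM.isCompact (e i)),
      hM.integral_interior_fderiv_eq hB, (crossCLM (e i)).integral_comp_comm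
        (hM.integrable_inner_normal_smul hB.continuousOn (e i))]
  rw [Finset.sum_congr rfl fun i _ => h i, ← integral_finsetSum _ fun i _ =>
    (crossCLM (e i)).integrable_comp (hM.integrable_inner_normal_smul hB.continuousOn (e i))]
  refine integral_congr_ae (Eventually.of_forall fun x => ?_)
  simp only [crossCLM_apply]
  rw [sum_cross_inner_smul, cross_swap]

end IsRegion

/-- The boundary theorem for a field that is a dual `I B` of a `C¹` vector field `B`. -/
lemma boundary_theorem_dual {M : Set E3} (hM : IsRegion M) {B : E3 → E3} (hB : IsC1UpTo M B)
    {F : E3 → G3} (hF : ∀ x ∈ M, F x = I3 * vec (B x)) :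
    IntegrableOn (fun x => dot I3 (mvDiv F x)) M volume ∧
      Integrable (fun x => comm (areaElement M x) (F x)) (surfaceMeasure M) ∧
      ∫ x in M, dot I3 (mvDiv F x) =
        ∫ x, comm (areaElement M x) (F x) ∂(surfaceMeasure M) := by
  -- `F = I B` is known on `M` only, so the derivatives can be compared only at interior points; the
  -- boundary is null for volume.
  have hvol : ∀ x ∈ interior M, dot I3 (mvDiv F x) = dualBivecCLM (-curl B x) := by
    intro x hx
    have he : F =ᶠ[𝓝 x] fun y => I3 * vec (B y) := by
      filter_upwards [isOpen_interior.mem_nhds hx] with y hy using hF y (interior_subset hy)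
    have hm : mvDiv F x = mvDiv (fun y => I3 * vec (B y)) x := by
      simp only [mvDiv, he.fderiv_eq]
    rw [hm, dot_I3_mvDiv_dual (hB.differentiableAt x hx), map_neg, dualBivecCLM_apply]
  have hsurf : ∀ x ∈ frontier M, comm (areaElement M x) (F x) =
      dualBivecCLM (cross (B x) (outwardNormal M x)) := fun x hx => by
    rw [hF x (hM.isClosed.frontier_subset hx), comm_areaElement, dualBivecCLM_apply]
  have hc := hM.integrableOn_curl hB
  have hn := hM.integrable_cross_outwardNormal hB.continuousOn
  refine ⟨?_, ?_, ?_⟩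
  · rw [hM.integrableOn_iff_interior]
    exact (dualBivecCLM.integrable_comp (hM.integrableOn_iff_interior.1 hc).neg).congr
      ((ae_restrict_iff' isOpen_interior.measurableSet).2
        (Eventually.of_forall fun x hx => (hvol x hx).symm))
  · exact (dualBivecCLM.integrable_comp hn).congr
      ((ae_restrict_iff' isClosed_frontier.measurableSet).2
        (Eventually.of_forall fun x hx => (hsurf x hx).symm))
  · have h1 : ∫ x, comm (areaElement M x) (F x) ∂(surfaceMeasure M) =
        ∫ x, dualBivecCLM (cross (B x) (outwardNormal M x)) ∂(surfaceMeasure M) :=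
      setIntegral_congr_fun isClosed_frontier.measurableSet hsurf
    have hi : Integrable (fun x => -curl B x) (volume.restrict (interior M)) :=
      (hM.integrableOn_iff_interior.1 hc).neg
    rw [h1, dualBivecCLM.integral_comp_comm hn, ← setIntegral_congr_set hM.interior_ae_eq,
      setIntegral_congr_fun isOpen_interior.measurableSet hvol,
      dualBivecCLM.integral_comp_comm hi, integral_neg,
      setIntegral_congr_set hM.interior_ae_eq, hM.integral_curl hB, neg_neg]

end GeomCalc

end

theorem mainTheorem2 (M : Set GeomCalc.E3) (hM : GeomCalc.IsRegion M) :
    -- the inner part of the boundary theorem, for bivector fields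
    (∀ F : GeomCalc.E3 → GeomCalc.G3, ContDiffOn ℝ 1 F M →
      (∀ x ∈ M, F x ∈ GeomCalc.grade 2) →
      IntegrableOn (fun x => GeomCalc.dot GeomCalc.I3 (GeomCalc.mvDiv F x)) M volume ∧
      Integrable (fun x => GeomCalc.comm (GeomCalc.areaElement M x) (F x))
        (GeomCalc.surfaceMeasure M) ∧
      ∫ x in M, GeomCalc.dot GeomCalc.I3 (GeomCalc.mvDiv F x) =
        ∫ x, GeomCalc.comm (GeomCalc.areaElement M x) (F x) ∂(GeomCalc.surfaceMeasure M)) ∧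
    -- its dual for vector fields `B`, through the bivector field `F = I B`
    (∀ B : GeomCalc.E3 → GeomCalc.E3, ContDiffOn ℝ 1 B M →
      (∀ x ∈ M, GeomCalc.I3 * GeomCalc.vec (B x) ∈ GeomCalc.grade 2) ∧
      (∀ x ∈ interior M,
        GeomCalc.dot GeomCalc.I3
            (GeomCalc.mvDiv (fun y => GeomCalc.I3 * GeomCalc.vec (B y)) x) =
          -(GeomCalc.I3 * GeomCalc.vec (GeomCalc.curl B x))) ∧
      (∀ x ∈ frontier M,
        GeomCalc.comm (GeomCalc.areaElement M x) (GeomCalc.I3 * GeomCalc.vec (B x)) =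
          GeomCalc.I3 * GeomCalc.vec (GeomCalc.cross (B x) (GeomCalc.outwardNormal M x))) ∧
      IntegrableOn (GeomCalc.curl B) M volume ∧
      Integrable (fun x => GeomCalc.cross (B x) (GeomCalc.outwardNormal M x))
        (GeomCalc.surfaceMeasure M) ∧
      ∫ x in M, GeomCalc.curl B x =
        -∫ x, GeomCalc.cross (B x) (GeomCalc.outwardNormal M x)
          ∂(GeomCalc.surfaceMeasure M)) := by
  refine ⟨fun F hF hgrade => ?_, fun B hB => ?_⟩
  -- A bivector field is `I B` with `B` its image under a linear map, so `B` is as smooth as `F`.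
  · have hB : ContDiffOn ℝ 1 (fun x => GeomCalc.dualVec (F x)) M :=
      GeomCalc.dualVec.toContinuousLinearMap.contDiff.comp_contDiffOn hF
    exact GeomCalc.boundary_theorem_dual hM (GeomCalc.isC1UpTo_of_contDiffOn hM.isCompact hB)
      fun x hx => (GeomCalc.I3_mul_vec_dualVec (hgrade x hx)).symm
  · have hB' := GeomCalc.isC1UpTo_of_contDiffOn hM.isCompact hB
    exact ⟨fun x _ => GeomCalc.I3_mul_vec_mem_grade _,
      fun x hx => GeomCalc.dot_I3_mvDiv_dual (hB'.differentiableAt x hx),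
      -- The identity holds for any vector in place of the normal, so also at singular points, where
      -- `outwardNormal` is zero.
      fun x _ => GeomCalc.comm_areaElement M x (B x), hM.integrableOn_curl hB',
      hM.integrable_cross_outwardNormal hB'.continuousOn, hM.integral_curl hB'⟩
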